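/- Let $k \ge 1$. Given $2k-1$ (not necessarily distinct) linear orders $\pi_1,\dots,\pi_{2k-1}$ of an $n$-element set $V$, the $k$-majority tournament they generate is the tournament on $V$ in which $(u,v)$ is an edge if and only if $u$ precedes $v$ in at least $k$ of the orders. For disjoint $A,B\subseteq V$, say that $A$ dominates $B$ in $\pi_i$ if every element of $A$ precedes every element of $B$ in $\pi_i$; that $A$ majority dominates $B$ if $A$ dominates $B$ in at least $k$ of the orders; and that $A$ and $B$ are consistent if for every $i$ one of $A,B$ dominates the other in $\pi_i$. Let $b_k(n)$ be the largest integer $t$ such that every $k$-majority tournament with $n$ vertices contains a $T_{t,t}$, that is, two disjoint sets of $t$ vertices each such that all edges between them go from the first set to the second. Let $d_k(n)$ (respectively $d_k^*(n)$) be the largest integer $t$ such that for all linear orders $\pi_1,\dots,\pi_{2k-1}$ of an $n$-element set there are disjoint subsets $A,B$ of size $t$ such that $A$ majority dominates $B$ (respectively, $A$ and $B$ are consistent). **Theorem.** For every $k\ge 1$ the following limits exist (as real numbers): $$b_k=\lim_{n\to\infty}\frac{n}{b_k(n)},\qquad d_k=\lim_{n\to\infty}\frac{n}{d_k(n)},\qquad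 d_k^*=\lim_{n\to\infty}\frac{n}{d_k^*(n)}.$$ Furthermore, there is an absolute constant $c>0$ such that for every $k\ge 1$ $$ck\le b_k\le\binom{2k}{k},\qquad \frac{2^k}{e}\le d_k\le\binom{2k}{k},\qquad \frac{2^{2k-1}}{e}\le d_k^*\le 2^{2k-1},$$ and $b_2=d_2=6$. -/

import Mathlib

open Filter Topology

namespace KMajority

/-- The digraph generated by `2k - 1` linear orders of `V` (repetitions allowed): `(u, v)` is an
edge if `u` precedes `v` in at least `k` of the orders. For `1 ≤ k` this is a tournament. -/
def majorityTournament (k : ℕ) {V : Type*} (π : Fin (2 * k - 1) → LinearOrder V) : Digraph V where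
  Adj u v := k ≤ Nat.card {i : Fin (2 * k - 1) // (π i).lt u v}

/-- `G` contains a copy of `T_{t,t}`: two disjoint vertex sets of size `t` with all edges
going from the first to the second. -/
def ContainsT {V : Type*} (G : Digraph V) (t : ℕ) : Prop :=
  ∃ A B : Finset V, Disjoint A B ∧ A.card = t ∧ B.card = t ∧ ∀ a ∈ A, ∀ b ∈ B, G.Adj a b

/-- `A` dominates `B` in the linear order `L`. -/
def Dominates {V : Type*} (L : LinearOrder V) (A B : Finset V) : Prop :=
  ∀ a ∈ A, ∀ b ∈ B, L.lt a b

/-- `A` dominates `B` in at least `k` of the `2k - 1` orders. -/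
def MajorityDominates (k : ℕ) {V : Type*} (π : Fin (2 * k - 1) → LinearOrder V)
    (A B : Finset V) : Prop :=
  k ≤ Nat.card {i : Fin (2 * k - 1) // Dominates (π i) A B}

/-- In each of the orders, one of `A` and `B` dominates the other. -/
def Consistent (k : ℕ) {V : Type*} (π : Fin (2 * k - 1) → LinearOrder V)
    (A B : Finset V) : Prop :=
  ∀ i, Dominates (π i) A B ∨ Dominates (π i) B A

/-- The `t` such that every `n`-vertex `k`-majority tournament contains a `T_{t,t}`. -/
def bSet (k n : ℕ) : Set ℕ :=
  {t | ∀ π : Fin (2 * k - 1) → LinearOrder (Fin n), ContainsT (majorityTournament k π) t}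

/-- The `t` such that for all `2k - 1` linear orders of an `n`-set there are disjoint `A`, `B` of
size `t` such that `A` majority dominates `B`. -/
def dSet (k n : ℕ) : Set ℕ :=
  {t | ∀ π : Fin (2 * k - 1) → LinearOrder (Fin n), ∃ A B : Finset (Fin n),
    Disjoint A B ∧ A.card = t ∧ B.card = t ∧ MajorityDominates k π A B}

/-- The `t` such that for all `2k - 1` linear orders of an `n`-set there are disjoint `A`, `B` of
size `t` which are consistent. -/
def dStarSet (k n : ℕ) : Set ℕ :=
  {t | ∀ π : Fin (2 * k - 1) → LinearOrder (Fin n), ∃ A B : Finset (Fin n),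
    Disjoint A B ∧ A.card = t ∧ B.card = t ∧ Consistent k π A B}

/-- `b_k(n)`, the largest element of `bSet k n`. -/
noncomputable def bNum (k n : ℕ) : ℕ := sSup (bSet k n)

/-- `d_k(n)`, the largest element of `dSet k n`. -/
noncomputable def dNum (k n : ℕ) : ℕ := sSup (dSet k n)

/-- `d*_k(n)`, the largest element of `dStarSet k n`. -/
noncomputable def dStarNum (k n : ℕ) : ℕ := sSup (dStarSet k n)

/-! The three suprema are maxima. -/

theorem isGreatest_sSup_of_le {S : Set ℕ} {n : ℕ} (h0 : 0 ∈ S) (h : ∀ t ∈ S, t ≤ n) :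
    IsGreatest S (sSup S) :=
  ⟨Nat.sSup_mem ⟨0, h0⟩ ⟨n, h⟩, fun _ ht => le_csSup ⟨n, h⟩ ht⟩

theorem card_le_of_eq {n t : ℕ} {A : Finset (Fin n)} (h : A.card = t) : t ≤ n := by
  simpa [h] using A.card_le_univ

theorem bNum_isGreatest (k n : ℕ) : IsGreatest (bSet k n) (bNum k n) := by
  refine isGreatest_sSup_of_le (n := n) (fun π => ⟨∅, ∅, by simp⟩) fun t ht => ?_
  obtain ⟨A, _, _, hA, _⟩ := ht fun _ => inferInstance
  exact card_le_of_eq hA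

theorem dNum_isGreatest {k : ℕ} (hk : 1 ≤ k) (n : ℕ) : IsGreatest (dSet k n) (dNum k n) := by
  refine isGreatest_sSup_of_le (n := n) (fun π => ⟨∅, ∅, by simp, rfl, rfl, ?_⟩) fun t ht => ?_
  · simp only [MajorityDominates, Dominates, Finset.notMem_empty, false_imp_iff, implies_true,
      Nat.card_eq_fintype_card, Fintype.card_subtype_true, Fintype.card_fin]
    omega
  · obtain ⟨A, _, _, hA, _⟩ := ht fun _ => inferInstance
    exact card_le_of_eq hA

theorem dStarNum_isGreatest (k n : ℕ) : IsGreatest (dStarSet k n) (dStarNum k n) := by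
  refine isGreatest_sSup_of_le (n := n)
    (fun π => ⟨∅, ∅, by simp, rfl, rfl, fun i => by simp [Dominates]⟩) fun t ht => ?_
  obtain ⟨A, _, _, hA, _⟩ := ht fun _ => inferInstance
  exact card_le_of_eq hA

end KMajority

/-!
The three maxima are treated alike. Each comes from a relation between disjoint vertex sets that
passes to images under maps compatible with the orders (`IsPairRelation`); write `f n` for the
largest size of a related pair that all orders of an `n`-set admit. Replacing every point of an
optimal example by `s` lexicographically ordered points gives `f (m * s) ≤ s * (f m + 1)`, since at
most one fibre can meet both sets. Hence `f n / n` converges, to the infimum of `(f m + 1) / m`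
(`exists_tendsto_div_of_mul_le`), and every single example bounds the limit of `n / f n` from below
(`IsPairRelation.exists_limit`).

Upper bounds for `n / f n`. The first order is cut in the middle, and each further order is cut at
a suitable place, keeping the part of `A` on one side and the part of `B` on the other. Halving
gives `2 ^ (2 k - 1)` for consistent sets; for majority domination the cut is weighted according to
the number of dominations still missing in either direction, and Pascal's recursion gives
`(2 k).choose k` (`exists_dominates_choose`). As majority domination puts all edges in the same
direction, the last bound holds for `b_k` too.

Lower bounds for `d_k` and `d*_k` are first moment computations: in a random order the set `A`
precedes `B` with probability `1 / (2 t).choose t`, and `two_pow_div_exp_le` compares the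
exponential rates.

The bound `c k ≤ b_k` comes from the affine plane over `ZMod q` with `q` a prime of the order of
`k`. For each slope there are two orders, which run through the lines of that slope in opposite
directions, but through each single line in the same direction. These pairs of orders cancel except
on their lines, so the edges within a line follow its direction, which is free to choose. By
Cauchy–Schwarz, two sets of `2 q` points both meet at least a third of the lines, and each such line
forces its direction; counting gives directions without a pair of sets of size `2 q`
(`exists_signs`).

For `6 ≤ b_2` a measure on the unit cube is discretized: six cells, each an image of the same cell
under one of the placements of its three coordinates in a low, a middle and a high third, all six
permutations of the thirds occurring. Between cells of equal parity the tournament is cyclic;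
between cells of opposite parity a single coordinate decides. The points of a cell lie on two
segments chosen such that a set and the points it precedes fill at most half of the cell
(`card_add_card_le_of_cell`). As the three coordinates have constant sum there, three parts of `A`
in the cells of one parity cannot coexist with three parts of `B` in the others.
`false_of_cell_sizes` combines these constraints with `card_add_sum_card_le`, according to which a
part of `B` that fills more than half of its cell is, inside a cell, almost disjoint from the parts
of `A` in the cells of opposite parity. Finally, `b_2 ≤ d_2 ≤ Nat.choose 4 2 = 6`.
-/

namespace KMajority

/-! ### Relations between vertex sets and the limits they define -/

/-- The map `φ` carries the orders `π'` to the orders `π`, except that it may collapse points: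
two points with distinct images compare as their images do. -/
def Compatible {k : ℕ} {V W : Type} (φ : V → W) (π' : Fin (2 * k - 1) → LinearOrder V)
    (π : Fin (2 * k - 1) → LinearOrder W) : Prop :=
  ∀ i x y, φ x ≠ φ y → ((π' i).lt x y ↔ (π i).lt (φ x) (φ y))

/-- What the three relations "all edges go from `A` to `B`", "`A` majority dominates `B`" and
"`A` and `B` are consistent" have in common, and all that is needed for the existence of the
limits: they pass to images under compatible maps, and two fibres of a compatible map cannot both
meet both of the sets. -/
structure IsPairRelation (k : ℕ)
    (Q : ∀ {V : Type}, (Fin (2 * k - 1) → LinearOrder V) → Finset V → Finset V → Prop) :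
    Prop where
  empty : ∀ {V : Type} (π : Fin (2 * k - 1) → LinearOrder V), Q π ∅ ∅
  map : ∀ {V W : Type} (φ : V → W) (π' : Fin (2 * k - 1) → LinearOrder V)
    (π : Fin (2 * k - 1) → LinearOrder W), Compatible φ π' π →
    ∀ (A B : Finset V) (A' B' : Finset W), (∀ a' ∈ A', ∃ a ∈ A, φ a = a') →
      (∀ b' ∈ B', ∃ b ∈ B, φ b = b') → Disjoint A' B' → Q π' A B → Q π A' B'
  cross : ∀ {V W : Type} (φ : V → W) (π' : Fin (2 * k - 1) → LinearOrder V)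
    (π : Fin (2 * k - 1) → LinearOrder W), Compatible φ π' π →
    ∀ (A B : Finset V), Q π' A B → ∀ a₁ ∈ A, ∀ a₂ ∈ A, ∀ b₁ ∈ B, ∀ b₂ ∈ B,
      φ a₁ = φ b₁ → φ a₂ = φ b₂ → φ a₁ = φ a₂

section PairRelation

variable {k : ℕ}
  {Q : ∀ {V : Type}, (Fin (2 * k - 1) → LinearOrder V) → Finset V → Finset V → Prop}

/-- The `t` such that all `2k - 1` orders of an `n`-set admit disjoint `t`-sets related by `Q`. -/
def pairSet (Q : ∀ {V : Type}, (Fin (2 * k - 1) → LinearOrder V) → Finset V → Finset V → Prop)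
    (n : ℕ) : Set ℕ :=
  {t | ∀ π : Fin (2 * k - 1) → LinearOrder (Fin n), ∃ A B : Finset (Fin n),
    Disjoint A B ∧ A.card = t ∧ B.card = t ∧ Q π A B}

/-- The largest `t` such that all `2k - 1` orders of an `n`-set admit disjoint `t`-sets related by
`Q`. -/
noncomputable def maxPair
    (Q : ∀ {V : Type}, (Fin (2 * k - 1) → LinearOrder V) → Finset V → Finset V → Prop)
    (n : ℕ) : ℕ := sSup (pairSet Q n)

theorem IsPairRelation.isGreatest (hQ : IsPairRelation k Q) (n : ℕ) :
    IsGreatest (pairSet Q n) (maxPair Q n) := by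
  refine isGreatest_sSup_of_le (n := n) (fun π => ⟨∅, ∅, by simp, rfl, rfl, hQ.empty π⟩)
    fun t ht => ?_
  obtain ⟨A, _, _, hA, _⟩ := ht fun _ => inferInstance
  exact card_le_of_eq hA

/-- One system of orders without related `t`-sets bounds the maximum, whatever its ground set. -/
theorem IsPairRelation.maxPair_lt (hQ : IsPairRelation k Q) {V : Type} [Fintype V] {n t : ℕ}
    (hn : Fintype.card V = n) (π : Fin (2 * k - 1) → LinearOrder V)
    (h : ∀ A B : Finset V, Disjoint A B → A.card = t → B.card = t → ¬ Q π A B) :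
    maxPair Q n < t := by
  by_contra! hle
  have e : Fin n ≃ V := (Fintype.equivFinOfCardEq hn).symm
  obtain ⟨A, B, hd, hA, hB, hq⟩ := (hQ.isGreatest n).1
    fun i => @LinearOrder.lift' _ _ (π i) e e.injective
  obtain ⟨A', hA', hA'c⟩ := Finset.exists_subset_card_eq (hle.trans hA.ge)
  obtain ⟨B', hB', hB'c⟩ := Finset.exists_subset_card_eq (hle.trans hB.ge)
  refine h (A'.map e.toEmbedding) (B'.map e.toEmbedding) ?_ (by simpa) (by simpa) ?_
  · exact (Finset.disjoint_map _).2 (hd.mono hA' hB')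
  · refine hQ.map e _ π ?_ A B _ _ ?_ ?_ ?_ hq
    · exact fun i x y _ => Iff.rfl
    · intro a ha
      obtain ⟨x, hx, rfl⟩ := Finset.mem_map.1 ha
      exact ⟨x, hA' hx, rfl⟩
    · intro a ha
      obtain ⟨x, hx, rfl⟩ := Finset.mem_map.1 ha
      exact ⟨x, hB' hx, rfl⟩
    · exact (Finset.disjoint_map _).2 (hd.mono hA' hB')

theorem IsPairRelation.le_maxPair (hQ : IsPairRelation k Q) {n t : ℕ} (h : t ∈ pairSet Q n) :
    t ≤ maxPair Q n := (hQ.isGreatest n).2 h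

theorem IsPairRelation.maxPair_le (hQ : IsPairRelation k Q) (n : ℕ) : maxPair Q n ≤ n := by
  obtain ⟨A, _, _, hA, _⟩ := (hQ.isGreatest n).1 fun _ => inferInstance
  exact card_le_of_eq hA

theorem IsPairRelation.monotone_maxPair (hQ : IsPairRelation k Q) :
    Monotone fun n => maxPair Q n := by
  intro m n hmn
  refine hQ.le_maxPair fun π => ?_
  let e := Fin.castLEEmb hmn
  obtain ⟨A, B, hd, hA, hB, hq⟩ := (hQ.isGreatest m).1
    fun i => @LinearOrder.lift' _ _ (π i) e e.injective
  have hd' := (Finset.disjoint_map e).2 hd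
  refine ⟨A.map e, B.map e, hd', by simpa, by simpa,
    hQ.map e _ π (fun i x y _ => Iff.rfl) A B _ _ ?_ ?_ hd' hq⟩
  · intro a ha
    simpa using ha
  · intro a ha
    simpa using ha

/-- Replacing every point by `s` points, ordered lexicographically, multiplies the maximum by
little more than `s`: at most one fibre meets both sets. -/
theorem IsPairRelation.maxPair_mul_le (hQ : IsPairRelation k Q) (m s : ℕ) :
    maxPair Q (m * s) ≤ s * (maxPair Q m + 1) := by
  classical
  set r := maxPair Q m + 1 with hr
  have hbad : r ∉ pairSet Q m := fun h => by
    have := hQ.le_maxPair h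
    omega
  obtain ⟨π, hπ⟩ : ∃ π : Fin (2 * k - 1) → LinearOrder (Fin m), ∀ A B : Finset (Fin m),
      Disjoint A B → A.card = r → B.card = r → ¬ Q π A B := by
    simpa [pairSet] using hbad
  refine Nat.lt_succ_iff.1 (hQ.maxPair_lt (V := Fin m ×ₗ Fin s) (t := s * r + 1)
    (by simp [Lex]) (fun i => @Prod.Lex.instLinearOrder _ _ (π i) inferInstance) ?_)
  intro A B _ hA hB hq
  set π' : Fin (2 * k - 1) → LinearOrder (Fin m ×ₗ Fin s) :=
    fun i => @Prod.Lex.instLinearOrder _ _ (π i) inferInstance with hπ'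
  let φ : Fin m ×ₗ Fin s → Fin m := fun x => (ofLex x).1
  have hc : Compatible φ π' π := by
    intro i x y hxy
    change Prod.Lex (π i).lt _ (ofLex x) (ofLex y) ↔ _
    rw [Prod.lex_def]
    exact ⟨fun h => h.resolve_right fun h => hxy h.1, Or.inl⟩
  have himg : ∀ S : Finset (Fin m ×ₗ Fin s), S.card = s * r + 1 → r + 1 ≤ (S.image φ).card := by
    intro S hS
    have h1 : S.card ≤ s * (S.image φ).card := by
      refine Finset.card_le_mul_card_image S s fun b _ => ?_
      have : (S.filter fun x => φ x = b).card ≤ (Finset.univ : Finset (Fin s)).card := by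
        refine Finset.card_le_card_of_injOn (fun x => (ofLex x).2) (by simp) ?_
        intro x hx y hy hxy
        simp only [Finset.coe_filter, Set.mem_ofPred_eq] at hx hy
        exact ofLex.injective (Prod.ext (hx.2.trans hy.2.symm) hxy)
      simpa using this
    rw [hS] at h1
    by_contra! h2
    have : s * (S.image φ).card ≤ s * r := Nat.mul_le_mul_left _ (by omega)
    omega
  have hAi := himg A hA
  have hBi := himg B hB
  have hI : (A.image φ ∩ B.image φ).card ≤ 1 := by
    refine Finset.card_le_one.2 fun v hv w hw => ?_
    simp only [Finset.mem_inter, Finset.mem_image] at hv hw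
    obtain ⟨⟨a₁, ha₁, rfl⟩, ⟨b₁, hb₁, h₁⟩⟩ := hv
    obtain ⟨⟨a₂, ha₂, rfl⟩, ⟨b₂, hb₂, h₂⟩⟩ := hw
    exact hQ.cross φ π' π hc A B hq a₁ ha₁ a₂ ha₂ b₁ hb₁ b₂ hb₂ h₁.symm h₂.symm
  have key : ∀ S T : Finset (Fin m), r + 1 ≤ S.card → (S ∩ T).card ≤ 1 → r ≤ (S \ T).card := by
    intro S T h1 h2
    have := Finset.card_sdiff_add_card_inter S T
    omega
  obtain ⟨A', hA', hA'c⟩ := Finset.exists_subset_card_eq (key _ (B.image φ) hAi hI)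
  obtain ⟨B', hB', hB'c⟩ := Finset.exists_subset_card_eq
    (key _ (A.image φ) hBi (by rwa [Finset.inter_comm]))
  have hd : Disjoint A' B' := by
    refine Finset.disjoint_left.2 fun x hxA hxB => ?_
    have h1 := Finset.mem_sdiff.1 (hA' hxA)
    have h2 := Finset.mem_sdiff.1 (hB' hxB)
    exact h2.2 h1.1
  refine hπ A' B' hd hA'c hB'c (hQ.map φ π' π hc A B A' B' ?_ ?_ hd hq)
  · exact fun a ha => Finset.mem_image.1 (Finset.mem_sdiff.1 (hA' ha)).1
  · exact fun b hb => Finset.mem_image.1 (Finset.mem_sdiff.1 (hB' hb)).1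

end PairRelation

/-- A monotone sequence with `f (m * s) ≤ s * (f m + 1)` grows linearly, and its rate is the
infimum of `(f m + 1) / m`. -/
theorem exists_tendsto_div_of_mul_le {f : ℕ → ℕ} (hf : Monotone f)
    (hmul : ∀ m s, f (m * s) ≤ s * (f m + 1)) :
    ∃ l : ℝ, Tendsto (fun n : ℕ => (f n : ℝ) / n) atTop (𝓝 l) ∧
      ∀ m : ℕ, 1 ≤ m → l ≤ ((f m : ℝ) + 1) / m := by
  set S : Set ℝ := (fun m : ℕ => ((f m : ℝ) + 1) / m) '' {m | 1 ≤ m} with hS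
  have hbdd : BddBelow S := ⟨0, by rintro _ ⟨m, -, rfl⟩; positivity⟩
  have hle : ∀ m : ℕ, 1 ≤ m → sInf S ≤ ((f m : ℝ) + 1) / m :=
    fun m hm => csInf_le hbdd ⟨m, hm, rfl⟩
  refine ⟨sInf S, ?_, hle⟩
  have hinv : Tendsto (fun n : ℕ => (1 : ℝ) / n) atTop (𝓝 0) :=
    tendsto_one_div_atTop_nhds_zero_nat
  rw [tendsto_order]
  constructor
  · intro a ha
    have : Tendsto (fun n : ℕ => sInf S - (1 : ℝ) / n) atTop (𝓝 (sInf S - 0)) :=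
      tendsto_const_nhds.sub hinv
    rw [sub_zero] at this
    filter_upwards [this.eventually (lt_mem_nhds ha), eventually_ge_atTop 1] with n h1 hn
    have := hle n hn
    rw [add_div] at this
    linarith
  · intro a ha
    obtain ⟨_, ⟨m, hm, rfl⟩, hma⟩ := exists_lt_of_csInf_lt (s := S) ⟨_, 1, le_refl 1, rfl⟩ ha
    have hm0 : (0 : ℝ) < m := by exact_mod_cast (show 0 < m from hm)
    have hlim : Tendsto (fun n : ℕ => (1 / (m : ℝ) + 1 / n) * ((f m : ℝ) + 1)) atTop
        (𝓝 ((1 / (m : ℝ) + 0) * ((f m : ℝ) + 1))) := (tendsto_const_nhds.add hinv).mul_const _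
    have hma' : (1 / (m : ℝ) + 0) * ((f m : ℝ) + 1) < a := by
      rw [add_zero, one_div_mul_eq_div]; exact hma
    filter_upwards [hlim.eventually (gt_mem_nhds hma'), eventually_ge_atTop 1] with n h1 hn
    refine lt_of_le_of_lt ?_ h1
    have hn0 : (0 : ℝ) < n := by exact_mod_cast (show 0 < n from hn)
    have h2 : f n ≤ (n / m + 1) * (f m + 1) := by
      refine (hf ?_).trans (hmul m (n / m + 1))
      exact (Nat.lt_mul_div_succ n hm).le
    have h3 : (f n : ℝ) ≤ ((n : ℝ) / m + 1) * ((f m : ℝ) + 1) := by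
      have h4 : (f n : ℝ) ≤ (((n / m : ℕ) : ℝ) + 1) * ((f m : ℝ) + 1) := by exact_mod_cast h2
      refine h4.trans ?_
      gcongr
      exact Nat.cast_div_le
    rw [div_le_iff₀ hn0]
    refine h3.trans (le_of_eq ?_)
    field_simp

/-- The limit of `n / f n`, for the maximum `f n` of a relation that always admits sets of size
`n / C`. The last clause bounds the limit from below by any single value of `f`. -/
theorem IsPairRelation.exists_limit {k : ℕ}
    {Q : ∀ {V : Type}, (Fin (2 * k - 1) → LinearOrder V) → Finset V → Finset V → Prop}
    (hQ : IsPairRelation k Q) {C : ℕ} (hC : 1 ≤ C) (h : ∀ n, n / C ≤ maxPair Q n) :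
    ∃ β : ℝ, Tendsto (fun n : ℕ => (n : ℝ) / (maxPair Q n : ℝ)) atTop (𝓝 β) ∧
      1 ≤ β ∧ β ≤ C ∧ ∀ m : ℕ, (m : ℝ) ≤ β * (maxPair Q m + 1) := by
  obtain ⟨l, hl, hm⟩ := exists_tendsto_div_of_mul_le hQ.monotone_maxPair hQ.maxPair_mul_le
  have hC0 : (0 : ℝ) < C := by exact_mod_cast (show 0 < C from hC)
  have hCl : 1 / (C : ℝ) ≤ l := by
    have hlim : Tendsto (fun n : ℕ => 1 / (C : ℝ) - (1 : ℝ) / n) atTop (𝓝 (1 / (C : ℝ) - 0)) :=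
      tendsto_const_nhds.sub tendsto_one_div_atTop_nhds_zero_nat
    rw [sub_zero] at hlim
    refine le_of_tendsto_of_tendsto hlim hl ?_
    filter_upwards [eventually_ge_atTop 1] with n hn
    have hn0 : (0 : ℝ) < n := by exact_mod_cast (show 0 < n from hn)
    rw [le_div_iff₀ hn0]
    have h1 : n < C * (n / C + 1) := Nat.lt_mul_div_succ n hC
    have h2 : n ≤ C * (maxPair Q n + 1) :=
      h1.le.trans (Nat.mul_le_mul_left _ (Nat.add_le_add_right (h n) 1))
    have h3 : (n : ℝ) ≤ C * ((maxPair Q n : ℝ) + 1) := by exact_mod_cast h2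
    have h4 : (n : ℝ) / C ≤ (maxPair Q n : ℝ) + 1 := by
      rw [div_le_iff₀ hC0]; linarith
    have h5 : (1 / (C : ℝ) - 1 / n) * n = n / C - 1 := by field_simp
    linarith
  have hl0 : 0 < l := lt_of_lt_of_le (by positivity) hCl
  have hl1 : l ≤ 1 := by
    refine le_of_tendsto hl ?_
    filter_upwards [eventually_ge_atTop 1] with n hn
    have hn0 : (0 : ℝ) < n := by exact_mod_cast (show 0 < n from hn)
    rw [div_le_one hn0]
    exact_mod_cast hQ.maxPair_le n
  refine ⟨l⁻¹, ?_, (one_le_inv₀ hl0).2 hl1, ?_, fun m => ?_⟩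
  · simpa [inv_div] using hl.inv₀ hl0.ne'
  · rw [inv_le_comm₀ hl0 hC0]
    simpa using hCl
  · rcases Nat.eq_zero_or_pos m with rfl | hm1
    · have := inv_pos.2 hl0
      push_cast
      positivity
    · have hm0 : (0 : ℝ) < m := by exact_mod_cast hm1
      have := hm m hm1
      rw [le_div_iff₀ hm0] at this
      rw [inv_mul_eq_div, le_div_iff₀ hl0]
      linarith

/-! ### The three relations -/

/-- All edges between `A` and `B` in the majority tournament go from `A` to `B`. -/
def MajorityPrecedes (k : ℕ) {V : Type} (π : Fin (2 * k - 1) → LinearOrder V)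
    (A B : Finset V) : Prop :=
  ∀ a ∈ A, ∀ b ∈ B, (majorityTournament k π).Adj a b

theorem Compatible.dominates {k : ℕ} {V W : Type} {φ : V → W}
    {π' : Fin (2 * k - 1) → LinearOrder V} {π : Fin (2 * k - 1) → LinearOrder W}
    (h : Compatible φ π' π) (i : Fin (2 * k - 1)) {A B : Finset V} {A' B' : Finset W}
    (hA : ∀ a' ∈ A', ∃ a ∈ A, φ a = a') (hB : ∀ b' ∈ B', ∃ b ∈ B, φ b = b')
    (hd : Disjoint A' B') (hAB : Dominates (π' i) A B) : Dominates (π i) A' B' := by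
  intro a' ha' b' hb'
  obtain ⟨a, ha, rfl⟩ := hA a' ha'
  obtain ⟨b, hb, rfl⟩ := hB b' hb'
  exact (h i a b (fun hab => Finset.disjoint_left.1 hd ha' (hab ▸ hb'))).1 (hAB a ha b hb)

theorem Compatible.eq_of_dominates {k : ℕ} {V W : Type} {φ : V → W}
    {π' : Fin (2 * k - 1) → LinearOrder V} {π : Fin (2 * k - 1) → LinearOrder W}
    (h : Compatible φ π' π) (i : Fin (2 * k - 1)) {A B : Finset V}
    (hAB : Dominates (π' i) A B) {a₁ a₂ b₁ b₂ : V} (ha₁ : a₁ ∈ A) (ha₂ : a₂ ∈ A) (hb₁ : b₁ ∈ B)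
    (hb₂ : b₂ ∈ B) (h₁ : φ a₁ = φ b₁) (h₂ : φ a₂ = φ b₂) : φ a₁ = φ a₂ := by
  by_contra hne
  have e₁ := (h i a₁ b₂ (h₂ ▸ hne)).1 (hAB a₁ ha₁ b₂ hb₂)
  have e₂ := (h i a₂ b₁ (h₁ ▸ Ne.symm hne)).1 (hAB a₂ ha₂ b₁ hb₁)
  rw [← h₂] at e₁
  rw [← h₁] at e₂
  let := π i
  exact lt_asymm e₁ e₂

theorem isPairRelation_majorityPrecedes {k : ℕ} (hk : 1 ≤ k) :
    IsPairRelation k (MajorityPrecedes k) where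
  empty π := by simp [MajorityPrecedes]
  map φ π' π hc A B A' B' hA hB hd h := by
    intro a' ha' b' hb'
    obtain ⟨a, ha, rfl⟩ := hA a' ha'
    obtain ⟨b, hb, rfl⟩ := hB b' hb'
    have hab : φ a ≠ φ b := fun hab => Finset.disjoint_left.1 hd ha' (hab ▸ hb')
    have := h a ha b hb
    simp only [majorityTournament] at this ⊢
    simpa only [hc _ a b hab] using this
  cross {V W} φ π' π hc A B h a₁ ha₁ a₂ ha₂ b₁ hb₁ b₂ hb₂ h₁ h₂ := by
    classical
    by_contra hne
    have e₁ := h a₁ ha₁ b₂ hb₂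
    have e₂ := h a₂ ha₂ b₁ hb₁
    simp only [majorityTournament] at e₁ e₂
    simp only [hc _ a₁ b₂ (h₂ ▸ hne), hc _ a₂ b₁ (h₁ ▸ Ne.symm hne), ← h₁, ← h₂,
      Nat.card_eq_fintype_card, Fintype.card_subtype] at e₁ e₂
    have hdisj : Disjoint (Finset.univ.filter fun i => (π i).lt (φ a₁) (φ a₂))
        (Finset.univ.filter fun i => (π i).lt (φ a₂) (φ a₁)) := by
      refine Finset.disjoint_filter.2 fun i _ h1 h2 => ?_
      let := π i
      exact lt_asymm h1 h2
    have := Finset.card_le_univ (Finset.disjUnion _ _ hdisj)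
    rw [Finset.card_disjUnion, Fintype.card_fin] at this
    omega

theorem isPairRelation_majorityDominates {k : ℕ} (hk : 1 ≤ k) :
    IsPairRelation k (MajorityDominates k) where
  empty π := by
    simp only [MajorityDominates, Dominates, Finset.notMem_empty, false_imp_iff, implies_true,
      Nat.card_eq_fintype_card, Fintype.card_subtype_true, Fintype.card_fin]
    omega
  map φ π' π hc A B A' B' hA hB hd h :=
    h.trans (Nat.card_le_card_of_injective
      (Subtype.map id fun i hi => hc.dominates i hA hB hd hi)
      (Subtype.map_injective _ Function.injective_id))
  cross φ π' π hc A B h a₁ ha₁ a₂ ha₂ b₁ hb₁ b₂ hb₂ h₁ h₂ := by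
    have : 0 < Nat.card {i // Dominates (π' i) A B} := lt_of_lt_of_le hk h
    obtain ⟨⟨i, hi⟩⟩ := (Nat.card_pos_iff.1 this).1
    exact hc.eq_of_dominates i hi ha₁ ha₂ hb₁ hb₂ h₁ h₂

theorem isPairRelation_consistent {k : ℕ} (hk : 1 ≤ k) :
    IsPairRelation k (Consistent k) where
  empty π i := by simp [Dominates]
  map φ π' π hc A B A' B' hA hB hd h i :=
    (h i).imp (hc.dominates i hA hB hd) (hc.dominates i hB hA hd.symm)
  cross φ π' π hc A B h a₁ ha₁ a₂ ha₂ b₁ hb₁ b₂ hb₂ h₁ h₂ := by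
    rcases h ⟨0, by omega⟩ with hi | hi
    · exact hc.eq_of_dominates _ hi ha₁ ha₂ hb₁ hb₂ h₁ h₂
    · rw [h₁, h₂]
      exact hc.eq_of_dominates _ hi hb₁ hb₂ ha₁ ha₂ h₁.symm h₂.symm

theorem bNum_eq (k n : ℕ) : bNum k n = maxPair (MajorityPrecedes k) n := rfl

theorem MajorityDominates.majorityPrecedes {k : ℕ} {V : Type}
    {π : Fin (2 * k - 1) → LinearOrder V} {A B : Finset V} (h : MajorityDominates k π A B) :
    MajorityPrecedes k π A B := fun a ha b hb =>
  h.trans (Nat.card_le_card_of_injective (Subtype.map id fun _ hi => hi a ha b hb)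
    (Subtype.map_injective _ Function.injective_id))

theorem dNum_le_bNum {k : ℕ} (hk : 1 ≤ k) (n : ℕ) : dNum k n ≤ bNum k n := by
  refine (bNum_isGreatest k n).2 fun π => ?_
  obtain ⟨A, B, hd, hA, hB, h⟩ := (dNum_isGreatest hk n).1 π
  exact ⟨A, B, hd, hA, hB, h.majorityPrecedes⟩

/-! ### Large dominating pairs in arbitrary orders -/

theorem exists_initial_subset {V : Type} [LinearOrder V] (A : Finset V) {p : ℕ}
    (hp : p ≤ A.card) : ∃ S T : Finset V, S ⊆ A ∧ T ⊆ A ∧ S.card = p ∧ p + T.card = A.card ∧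
      ∀ x ∈ S, ∀ y ∈ T, x < y := by
  suffices h : ∃ S ⊆ A, S.card = p ∧ ∀ x ∈ S, ∀ y ∈ A \ S, x < y by
    obtain ⟨S, hS, hc, hlt⟩ := h
    refine ⟨S, A \ S, hS, Finset.sdiff_subset, hc, ?_, hlt⟩
    have := Finset.card_sdiff_add_card_eq_card hS
    omega
  induction p with
  | zero => exact ⟨∅, by simp, rfl, by simp⟩
  | succ p ih =>
    obtain ⟨S, hS, hc, hlt⟩ := ih (by omega)
    have hne : (A \ S).Nonempty := by
      rw [← Finset.card_pos]
      have := Finset.card_sdiff_add_card_eq_card hS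
      omega
    have hm := Finset.min'_mem _ hne
    have hm' := Finset.mem_sdiff.1 hm
    refine ⟨insert ((A \ S).min' hne) S, Finset.insert_subset hm'.1 hS, ?_, ?_⟩
    · rw [Finset.card_insert_of_notMem hm'.2, hc]
    · intro x hx y hy
      simp only [Finset.mem_sdiff, Finset.mem_insert, not_or] at hy
      have hy' : y ∈ A \ S := Finset.mem_sdiff.2 ⟨hy.1, hy.2.2⟩
      rcases Finset.mem_insert.1 hx with rfl | hx
      · exact lt_of_le_of_ne (Finset.min'_le _ _ hy') (Ne.symm hy.2.1)
      · exact hlt x hx y hy'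

/-- Cutting one order after the first `p` elements of `A`: either `p` elements of `B` lie above
the cut, or the rest of `A` lies above more than `q` elements of `B`. -/
theorem exists_dominates_or_dominates {V : Type} (L : LinearOrder V) {A B : Finset V}
    {p q : ℕ} (hA : p + q ≤ A.card) (hB : p + q ≤ B.card) :
    ∃ A' ⊆ A, ∃ B' ⊆ B, (p ≤ A'.card ∧ p ≤ B'.card ∧ Dominates L A' B') ∨
      (q ≤ A'.card ∧ q ≤ B'.card ∧ Dominates L B' A') := by
  obtain ⟨S, T, hS, hT, hSc, hTc, hlt⟩ := exists_initial_subset A (p := p) (by omega)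
  rcases S.eq_empty_or_nonempty with rfl | hne
  · refine ⟨∅, by simp, ∅, by simp, Or.inl ⟨?_, ?_, by simp [Dominates]⟩⟩ <;>
      simp at hSc ⊢ <;> omega
  have hm := Finset.max'_mem S hne
  set x := S.max' hne
  have hsum := Finset.card_filter_add_card_filter_not (s := B) (fun b => x < b)
  rcases le_or_gt p (B.filter fun b => x < b).card with h | h
  · refine ⟨S, hS, _, Finset.filter_subset _ _, Or.inl ⟨hSc.ge, h, fun a ha b hb => ?_⟩⟩
    exact lt_of_le_of_lt (S.le_max' a ha) (Finset.mem_filter.1 hb).2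
  · refine ⟨T, hT, B.filter fun b => ¬ x < b, Finset.filter_subset _ _,
      Or.inr ⟨by omega, by omega, fun b hb a ha => ?_⟩⟩
    exact lt_of_le_of_lt (not_lt.1 (Finset.mem_filter.1 hb).2) (hlt x hm a ha)

/-- With `a + b - 1` further orders, the sizes `|A'|`, `|B'|` needed to get either `a`
dominations of `B'` by `A'` or `b` of `A'` by `B'` obey Pascal's recursion: each cut is placed
in the ratio of the two binomial coefficients that remain. -/
theorem exists_dominates_choose {V ι : Type} [DecidableEq ι] (π : ι → LinearOrder V) (t : ℕ)
    (I : Finset ι) : ∀ (a b : ℕ) (A B : Finset V), a + b ≤ I.card + 1 →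
    (a + b).choose a * t ≤ A.card → (a + b).choose a * t ≤ B.card →
    ∃ A' ⊆ A, ∃ B' ⊆ B, A'.card = t ∧ B'.card = t ∧
      ((∃ J ⊆ I, J.card = a ∧ ∀ i ∈ J, Dominates (π i) A' B') ∨
        ∃ J ⊆ I, J.card = b ∧ ∀ i ∈ J, Dominates (π i) B' A') := by
  have triv : ∀ (I : Finset ι) (a b : ℕ) (A B : Finset V), a = 0 ∨ b = 0 →
      (a + b).choose a * t ≤ A.card → (a + b).choose a * t ≤ B.card →
      ∃ A' ⊆ A, ∃ B' ⊆ B, A'.card = t ∧ B'.card = t ∧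
      ((∃ J ⊆ I, J.card = a ∧ ∀ i ∈ J, Dominates (π i) A' B') ∨
        ∃ J ⊆ I, J.card = b ∧ ∀ i ∈ J, Dominates (π i) B' A') := by
    intro I a b A B h hA hB
    have hch : (a + b).choose a = 1 := by rcases h with rfl | rfl <;> simp
    rw [hch, one_mul] at hA hB
    obtain ⟨A', hA', hAc⟩ := Finset.exists_subset_card_eq hA
    obtain ⟨B', hB', hBc⟩ := Finset.exists_subset_card_eq hB
    refine ⟨A', hA', B', hB', hAc, hBc, h.imp ?_ ?_⟩ <;>
      exact fun h => ⟨∅, by simp, by simp [h], by simp⟩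
  induction I using Finset.induction_on with
  | empty =>
    intro a b A B h hA hB
    exact triv _ a b A B (by simp at h; omega) hA hB
  | insert i I hi ih =>
    intro a b A B h hA hB
    rcases a with _ | a
    · exact triv _ 0 b A B (Or.inl rfl) hA hB
    rcases b with _ | b
    · exact triv _ (a + 1) 0 A B (Or.inr rfl) hA hB
    have hpas : (a + 1 + (b + 1)).choose (a + 1) * t =
        (a + (b + 1)).choose a * t + (a + 1 + b).choose (a + 1) * t := by
      rw [← add_mul, show a + 1 + (b + 1) = (a + b + 1) + 1 by ring, Nat.choose_succ_succ,
        show a + (b + 1) = a + b + 1 by ring, show a + 1 + b = a + b + 1 by ring]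
    rw [hpas] at hA hB
    rw [Finset.card_insert_of_notMem hi] at h
    obtain ⟨A₁, hA₁, B₁, hB₁, ⟨h1, h2, h3⟩ | ⟨h1, h2, h3⟩⟩ :=
      exists_dominates_or_dominates (π i) hA hB
    · obtain ⟨A', hA', B', hB', hAc, hBc, hJ⟩ := ih a (b + 1) A₁ B₁ (by omega) h1 h2
      refine ⟨A', hA'.trans hA₁, B', hB'.trans hB₁, hAc, hBc, hJ.imp ?_ ?_⟩
      · rintro ⟨J, hJI, hJc, hJ⟩
        refine ⟨insert i J, Finset.insert_subset_insert _ hJI, ?_, ?_⟩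
        · rw [Finset.card_insert_of_notMem fun h => hi (hJI h), hJc]
        · refine Finset.forall_mem_insert _ _ _ |>.2 ⟨?_, hJ⟩
          exact fun x hx y hy => h3 x (hA' hx) y (hB' hy)
      · rintro ⟨J, hJI, hJ⟩
        exact ⟨J, hJI.trans (Finset.subset_insert _ _), hJ⟩
    · obtain ⟨A', hA', B', hB', hAc, hBc, hJ⟩ := ih (a + 1) b A₁ B₁ (by omega) h1 h2
      refine ⟨A', hA'.trans hA₁, B', hB'.trans hB₁, hAc, hBc, hJ.imp ?_ ?_⟩
      · rintro ⟨J, hJI, hJ⟩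
        exact ⟨J, hJI.trans (Finset.subset_insert _ _), hJ⟩
      · rintro ⟨J, hJI, hJc, hJ⟩
        refine ⟨insert i J, Finset.insert_subset_insert _ hJI, ?_, ?_⟩
        · rw [Finset.card_insert_of_notMem fun h => hi (hJI h), hJc]
        · refine Finset.forall_mem_insert _ _ _ |>.2 ⟨?_, hJ⟩
          exact fun x hx y hy => h3 x (hB' hx) y (hA' hy)

theorem exists_consistent_of_two_pow {V ι : Type} [DecidableEq ι] (π : ι → LinearOrder V) (t : ℕ)
    (I : Finset ι) : ∀ A B : Finset V,
    2 ^ I.card * t ≤ A.card → 2 ^ I.card * t ≤ B.card →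
    ∃ A' ⊆ A, ∃ B' ⊆ B, A'.card = t ∧ B'.card = t ∧
      ∀ i ∈ I, Dominates (π i) A' B' ∨ Dominates (π i) B' A' := by
  induction I using Finset.induction_on with
  | empty =>
    intro A B hA hB
    simp only [Finset.card_empty, pow_zero, one_mul] at hA hB
    obtain ⟨A', hA', hAc⟩ := Finset.exists_subset_card_eq hA
    obtain ⟨B', hB', hBc⟩ := Finset.exists_subset_card_eq hB
    exact ⟨A', hA', B', hB', hAc, hBc, by simp⟩
  | insert i I hi ih =>
    intro A B hA hB
    rw [Finset.card_insert_of_notMem hi, pow_succ, mul_assoc, mul_left_comm, two_mul] at hA hB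
    obtain ⟨A₁, hA₁, B₁, hB₁, h⟩ := exists_dominates_or_dominates (π i) hA hB
    have hc : 2 ^ I.card * t ≤ A₁.card ∧ 2 ^ I.card * t ≤ B₁.card := by
      rcases h with h | h <;> exact ⟨h.1, h.2.1⟩
    obtain ⟨A', hA', B', hB', hAc, hBc, hJ⟩ := ih A₁ B₁ hc.1 hc.2
    refine ⟨A', hA'.trans hA₁, B', hB'.trans hB₁, hAc, hBc, ?_⟩
    refine Finset.forall_mem_insert _ _ _ |>.2 ⟨?_, hJ⟩
    refine h.imp (fun h x hx y hy => ?_) (fun h x hx y hy => ?_)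
    · exact h.2.2 x (hA' hx) y (hB' hy)
    · exact h.2.2 x (hB' hx) y (hA' hy)

/-- The first order costs only a factor `2`, as its halves are the first two sets. -/
theorem exists_dominates_half {V : Type} [Fintype V] {s : ℕ} (L : LinearOrder V)
    (h : 2 * s ≤ Fintype.card V) : ∃ A B : Finset V, Disjoint A B ∧ s ≤ A.card ∧ s ≤ B.card ∧ Dominates L A B := by
  obtain ⟨S, T, -, -, hS, hT, hlt⟩ := exists_initial_subset (Finset.univ : Finset V) (p := s)
    (by rw [Finset.card_univ]; omega)
  rw [Finset.card_univ] at hT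
  refine ⟨S, T, Finset.disjoint_left.2 fun x hx hy => ?_, hS.ge, by omega, hlt⟩
  exact lt_irrefl x (hlt x hx x hy)

theorem div_choose_le_dNum {k : ℕ} (hk : 1 ≤ k) (n : ℕ) : n / (2 * k).choose k ≤ dNum k n := by
  classical
  obtain ⟨j, rfl⟩ : ∃ j, k = j + 1 := ⟨k - 1, by omega⟩
  refine (dNum_isGreatest hk n).2 fun π => ?_
  set t := n / (2 * (j + 1)).choose (j + 1)
  have ht : (2 * (j + 1)).choose (j + 1) * t ≤ n := Nat.mul_div_le _ _
  have hch : (2 * (j + 1)).choose (j + 1) = 2 * (j + (j + 1)).choose j := by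
    rw [show 2 * (j + 1) = (2 * j + 1) + 1 by ring, Nat.choose_succ_succ,
      Nat.choose_symm_half, show j + (j + 1) = 2 * j + 1 by ring, two_mul (Nat.choose _ _)]
  rw [hch, mul_assoc] at ht
  let i₀ : Fin (2 * (j + 1) - 1) := ⟨0, by omega⟩
  obtain ⟨A, B, hd, hA, hB, hdom⟩ := exists_dominates_half (π i₀)
    (by rwa [Fintype.card_fin])
  have hcard : (Finset.univ.erase i₀).card = 2 * j := by
    rw [Finset.card_erase_of_mem (Finset.mem_univ _), Finset.card_univ, Fintype.card_fin]
    omega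
  obtain ⟨A', hA', B', hB', hAc, hBc, ⟨J, hJI, hJc, hJ⟩ | ⟨J, hJI, hJc, hJ⟩⟩ :=
    exists_dominates_choose π t (Finset.univ.erase i₀) j (j + 1) A B (by omega) hA hB
  · refine ⟨A', B', hd.mono hA' hB', hAc, hBc, ?_⟩
    have hi : i₀ ∉ J := fun h => Finset.notMem_erase _ _ (hJI h)
    rw [MajorityDominates, Nat.card_eq_fintype_card, Fintype.card_subtype]
    have hic := Finset.card_insert_of_notMem hi
    rw [hJc] at hic
    refine hic.ge.trans (Finset.card_le_card ?_)
    refine Finset.insert_subset ?_ fun i hi => ?_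
    · exact Finset.mem_filter.2 ⟨Finset.mem_univ _, fun x hx y hy =>
        hdom x (hA' hx) y (hB' hy)⟩
    · exact Finset.mem_filter.2 ⟨Finset.mem_univ _, hJ i hi⟩
  · refine ⟨B', A', (hd.mono hA' hB').symm, hBc, hAc, ?_⟩
    rw [MajorityDominates, Nat.card_eq_fintype_card, Fintype.card_subtype]
    refine hJc.ge.trans (Finset.card_le_card fun i hi => ?_)
    exact Finset.mem_filter.2 ⟨Finset.mem_univ _, hJ i hi⟩

theorem div_two_pow_le_dStarNum {k : ℕ} (hk : 1 ≤ k) (n : ℕ) :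
    n / 2 ^ (2 * k - 1) ≤ dStarNum k n := by
  classical
  refine (dStarNum_isGreatest k n).2 fun π => ?_
  set t := n / 2 ^ (2 * k - 1)
  have ht : 2 ^ (2 * k - 1) * t ≤ n := Nat.mul_div_le _ _
  rw [show 2 * k - 1 = (2 * k - 2) + 1 by omega, pow_succ', mul_assoc] at ht
  let i₀ : Fin (2 * k - 1) := ⟨0, by omega⟩
  obtain ⟨A, B, hd, hA, hB, hdom⟩ := exists_dominates_half (π i₀)
    (by rwa [Fintype.card_fin])
  have hcard : (Finset.univ.erase i₀).card = 2 * k - 2 := by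
    rw [Finset.card_erase_of_mem (Finset.mem_univ _), Finset.card_univ, Fintype.card_fin]
    omega
  obtain ⟨A', hA', B', hB', hAc, hBc, hJ⟩ :=
    exists_consistent_of_two_pow π t (Finset.univ.erase i₀) A B (by rwa [hcard]) (by rwa [hcard])
  refine ⟨A', B', hd.mono hA' hB', hAc, hBc, fun i => ?_⟩
  by_cases hi : i = i₀
  · subst hi
    exact Or.inl fun x hx y hy => hdom x (hA' hx) y (hB' hy)
  · exact hJ i (Finset.mem_erase.2 ⟨hi, Finset.mem_univ _⟩)

/-! ### The first moment method for random orders -/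

/-- The permutations, read as linear orders, in which `A` precedes `B`. -/
def precedingPerms {n : ℕ} (A B : Finset (Fin n)) : Finset (Equiv.Perm (Fin n)) :=
  Finset.univ.filter fun σ => ∀ a ∈ A, ∀ b ∈ B, σ a < σ b

theorem mem_precedingPerms {n : ℕ} {A B : Finset (Fin n)} {σ : Equiv.Perm (Fin n)} :
    σ ∈ precedingPerms A B ↔ ∀ a ∈ A, ∀ b ∈ B, σ a < σ b := by
  simp [precedingPerms]

theorem exists_perm_image {n : ℕ} {X S T : Finset (Fin n)} (hS : S ⊆ X) (hT : T ⊆ X)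
    (h : S.card = T.card) :
    ∃ g : Equiv.Perm (Fin n), (∀ x, g x ∈ T ↔ x ∈ S) ∧ ∀ x, g x ∈ X ↔ x ∈ X := by
  classical
  let col : Finset (Fin n) → Fin n → Fin 3 := fun U x =>
    if x ∈ U then 0 else if x ∈ X then 1 else 2
  have hcol : ∀ U ⊆ X, ∀ c, (Finset.univ.filter fun x => col U x = c).card =
      if c = 0 then U.card else if c = 1 then X.card - U.card else n - X.card := by
    intro U hU c
    have h0 : (Finset.univ.filter fun x => col U x = 0) = U := by
      ext x; simp only [col, Finset.mem_filter, Finset.mem_univ, true_and]; split_ifs <;> simp_all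
    have h1 : (Finset.univ.filter fun x => col U x = 1) = X \ U := by
      ext x; simp only [col, Finset.mem_filter, Finset.mem_univ, true_and, Finset.mem_sdiff]
      split_ifs <;> simp_all
    have h2 : (Finset.univ.filter fun x => col U x = 2) = Xᶜ := by
      ext x
      have := @hU x
      simp only [col, Finset.mem_filter, Finset.mem_univ, true_and, Finset.mem_compl]
      split_ifs <;> simp_all
    fin_cases c
    · simp [h0]
    · simp [h1, Finset.card_sdiff_of_subset hU]
    · simp [h2, Finset.card_compl]
  have hfib : ∀ c, Nonempty ({x // col S x = c} ≃ {x // col T x = c}) := by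
    intro c
    refine ⟨Fintype.equivOfCardEq ?_⟩
    rw [Fintype.card_subtype, Fintype.card_subtype, hcol S hS, hcol T hT, h]
  let g : Equiv.Perm (Fin n) := Equiv.ofFiberEquiv fun c => (hfib c).some
  have hg : ∀ x, col T (g x) = col S x := Equiv.ofFiberEquiv_map _
  refine ⟨g, fun x => ?_, fun x => ?_⟩
  · have := hg x
    simp only [col] at this
    split_ifs at this <;> simp_all
  · have := hg x
    have h1 := @hS x
    have h2 := @hT (g x)
    simp only [col] at this
    split_ifs at this <;> simp_all

/-- For a random order, each `t`-subset of the `2t` elements of `A ∪ B` is equally likely to come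
first. -/
theorem choose_mul_card_precedingPerms_le {n t : ℕ} {A B : Finset (Fin n)} (hd : Disjoint A B)
    (hA : A.card = t) (hB : B.card = t) :
    (2 * t).choose t * (precedingPerms A B).card ≤ Fintype.card (Equiv.Perm (Fin n)) := by
  classical
  set X := A ∪ B with hX
  have hXc : X.card = 2 * t := by rw [hX, Finset.card_union_of_disjoint hd]; omega
  have hBX : B = X \ A := by rw [hX, Finset.union_sdiff_cancel_left hd]
  have hdisj : (Finset.powersetCard t X : Set (Finset (Fin n))).PairwiseDisjoint
      fun T => precedingPerms T (X \ T) := by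
    intro S hS T hT hne
    rw [Finset.mem_coe, Finset.mem_powersetCard] at hS hT
    refine Finset.disjoint_left.2 fun σ h1 h2 => ?_
    rw [mem_precedingPerms] at h1 h2
    have hST : ¬ S ⊆ T := fun h => hne (Finset.eq_of_subset_of_card_le h (by omega))
    have hTS : ¬ T ⊆ S := fun h => hne (Finset.eq_of_subset_of_card_le h (by omega)).symm
    obtain ⟨x, hxS, hxT⟩ := Finset.not_subset.1 hST
    obtain ⟨y, hyT, hyS⟩ := Finset.not_subset.1 hTS
    exact lt_asymm (h1 x hxS y (Finset.mem_sdiff.2 ⟨hT.1 hyT, hyS⟩))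
      (h2 y hyT x (Finset.mem_sdiff.2 ⟨hS.1 hxS, hxT⟩))
  have hle : ∀ T ∈ Finset.powersetCard t X,
      (precedingPerms A B).card ≤ (precedingPerms T (X \ T)).card := by
    intro T hT
    rw [Finset.mem_powersetCard] at hT
    obtain ⟨g, hg, hgX⟩ := exists_perm_image (Finset.subset_union_left : A ⊆ X) hT.1
      (by rw [hA, hT.2])
    refine Finset.card_le_card_of_injOn (fun σ => g.symm.trans σ) ?_ ?_
    · intro σ hσ
      rw [Finset.mem_coe, mem_precedingPerms] at hσ ⊢
      intro a ha b hb
      have ha' : g.symm a ∈ A := by rw [← hg]; simpa using ha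
      have hb' : g.symm b ∈ B := by
        rw [hBX, Finset.mem_sdiff, ← hg, ← hgX, Equiv.apply_symm_apply]
        exact Finset.mem_sdiff.1 hb
      exact hσ _ ha' _ hb'
    · intro σ _ τ _ h
      refine Equiv.ext fun x => ?_
      have := congrArg (fun ρ : Equiv.Perm (Fin n) => ρ (g x)) h
      simpa using this
  calc (2 * t).choose t * (precedingPerms A B).card
      = ∑ _T ∈ Finset.powersetCard t X, (precedingPerms A B).card := by
        rw [Finset.sum_const, Finset.card_powersetCard, hXc, smul_eq_mul]
    _ ≤ ∑ T ∈ Finset.powersetCard t X, (precedingPerms T (X \ T)).card := Finset.sum_le_sum hle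
    _ = ((Finset.powersetCard t X).biUnion fun T => precedingPerms T (X \ T)).card :=
        (Finset.card_biUnion hdisj).symm
    _ ≤ _ := Finset.card_le_univ _

/-- The union bound: if the events "`σ i ∈ F p` for all `i ∈ S p`", with `m` independent uniform
`σ i`, cover everything, then they are many. -/
theorem pow_le_card_mul_pow {ι α : Type} [Fintype α] [Nonempty α] [DecidableEq α] {m c w r : ℕ}
    (P : Finset ι) (S : ι → Finset (Fin m)) (F : ι → Finset α)
    (hF : ∀ p ∈ P, c * (F p).card ≤ w * Fintype.card α) (hS : ∀ p ∈ P, (S p).card = r)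
    (hcov : ∀ σ : Fin m → α, ∃ p ∈ P, ∀ i ∈ S p, σ i ∈ F p) : c ^ r ≤ P.card * w ^ r := by
  classical
  set N := Fintype.card α with hN
  have hN0 : 0 < N := Fintype.card_pos
  let G : ι → Finset (Fin m → α) := fun p =>
    Fintype.piFinset fun i => if i ∈ S p then F p else Finset.univ
  have hG : ∀ p ∈ P, c ^ r * (G p).card ≤ w ^ r * N ^ m := by
    intro p hp
    have h1 : (G p).card = (F p).card ^ r * N ^ (m - r) := by
      have : ∀ i, (if i ∈ S p then F p else Finset.univ : Finset α).card =
          if i ∈ S p then (F p).card else N := fun i => by split_ifs <;> simp [hN]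
      rw [Fintype.card_piFinset]
      simp only [this]
      rw [Finset.prod_ite, Finset.prod_const, Finset.prod_const]
      have h2 : (Finset.univ.filter fun i => i ∈ S p) = S p := by ext; simp
      have h3 : (Finset.univ.filter fun i => i ∉ S p) = (S p)ᶜ := by ext; simp
      rw [h2, h3, Finset.card_compl, Fintype.card_fin, hS p hp]
    have hrm : r ≤ m := by
      rw [← hS p hp]
      simpa using Finset.card_le_univ (S p)
    calc c ^ r * (G p).card = (c * (F p).card) ^ r * N ^ (m - r) := by rw [h1, mul_pow]; ring
      _ ≤ (w * N) ^ r * N ^ (m - r) := Nat.mul_le_mul_right _ (Nat.pow_le_pow_left (hF p hp) r)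
      _ = w ^ r * N ^ m := by
        rw [mul_pow, mul_assoc, ← pow_add, Nat.add_sub_cancel' hrm]
  have hcover : (Finset.univ : Finset (Fin m → α)) ⊆ P.biUnion G := by
    intro σ _
    obtain ⟨p, hp, h⟩ := hcov σ
    refine Finset.mem_biUnion.2 ⟨p, hp, Fintype.mem_piFinset.2 fun i => ?_⟩
    by_cases hi : i ∈ S p
    · simpa [hi] using h i hi
    · simp [hi]
  have h1 : N ^ m ≤ ∑ p ∈ P, (G p).card := by
    have := (Finset.card_le_card hcover).trans Finset.card_biUnion_le
    simpa [hN] using this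
  have h2 : c ^ r * N ^ m ≤ (P.card * w ^ r) * N ^ m := by
    calc c ^ r * N ^ m ≤ c ^ r * ∑ p ∈ P, (G p).card := Nat.mul_le_mul_left _ h1
      _ = ∑ p ∈ P, c ^ r * (G p).card := Finset.mul_sum _ _ _
      _ ≤ ∑ _p ∈ P, w ^ r * N ^ m := Finset.sum_le_sum hG
      _ = (P.card * w ^ r) * N ^ m := by rw [Finset.sum_const, smul_eq_mul, mul_assoc]
  exact Nat.le_of_mul_le_mul_right h2 (pow_pos hN0 m)

/-- The ordered pairs of disjoint `t`-sets. -/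
def disjointPairs (n t : ℕ) : Finset ((_ : Finset (Fin n)) × Finset (Fin n)) :=
  (Finset.powersetCard t Finset.univ).sigma fun A => Finset.powersetCard t Aᶜ

theorem mem_disjointPairs {n t : ℕ} {p : (_ : Finset (Fin n)) × Finset (Fin n)} :
    p ∈ disjointPairs n t ↔ Disjoint p.1 p.2 ∧ p.1.card = t ∧ p.2.card = t := by
  simp only [disjointPairs, Finset.mem_sigma, Finset.mem_powersetCard, Finset.subset_univ,
    true_and, Finset.subset_compl_comm (s := p.2), Finset.subset_compl_iff_disjoint_right]
  tauto

theorem card_disjointPairs (n t : ℕ) :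
    (disjointPairs n t).card = n.choose (2 * t) * (2 * t).choose t := by
  rw [disjointPairs, Finset.card_sigma, Finset.sum_congr rfl (g := fun _ => (n - t).choose t),
    Finset.sum_const, Finset.card_powersetCard, Finset.card_univ, Fintype.card_fin, smul_eq_mul,
    Nat.choose_mul (by omega : t ≤ 2 * t), show 2 * t - t = t by omega]
  intro A hA
  rw [Finset.card_powersetCard, Finset.card_compl, Fintype.card_fin,
    (Finset.mem_powersetCard.1 hA).2]

/-- The linear order on `Fin n` given by a permutation. -/
abbrev permOrder {n : ℕ} (σ : Equiv.Perm (Fin n)) : LinearOrder (Fin n) :=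
  LinearOrder.lift' σ σ.injective

theorem dominates_permOrder {n : ℕ} {σ : Equiv.Perm (Fin n)} {A B : Finset (Fin n)} :
    Dominates (permOrder σ) A B ↔ σ ∈ precedingPerms A B := by
  rw [mem_precedingPerms]
  rfl

theorem centralBinom_pow_le_of_dNum (j n : ℕ) :
    (2 * dNum (j + 1) n).choose (dNum (j + 1) n) ^ j ≤
      n.choose (2 * dNum (j + 1) n) * 2 ^ (2 * j + 1) := by
  classical
  set t := dNum (j + 1) n
  have hmem : t ∈ dSet (j + 1) n := (dNum_isGreatest (by omega) n).1
  have key := pow_le_card_mul_pow (c := (2 * t).choose t) (w := 1) (r := j + 1)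
    (m := 2 * (j + 1) - 1)
    (disjointPairs n t ×ˢ Finset.powersetCard (j + 1) Finset.univ) (fun p => p.2)
    (fun p => precedingPerms p.1.1 p.1.2) ?_ ?_ ?_
  · rw [Finset.card_product, card_disjointPairs, Finset.card_powersetCard, Finset.card_univ,
      Fintype.card_fin, one_pow, mul_one, pow_succ] at key
    have hc : (2 * (j + 1) - 1).choose (j + 1) ≤ 2 ^ (2 * j + 1) := Nat.choose_le_two_pow _ _
    have hpos : 0 < (2 * t).choose t := Nat.choose_pos (by omega)
    refine Nat.le_of_mul_le_mul_right (key.trans ?_) hpos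
    calc _ ≤ n.choose (2 * t) * (2 * t).choose t * 2 ^ (2 * j + 1) := Nat.mul_le_mul_left _ hc
      _ = _ := by ring
  · intro p hp
    obtain ⟨hd, hA, hB⟩ := mem_disjointPairs.1 (Finset.mem_product.1 hp).1
    rw [one_mul]
    exact choose_mul_card_precedingPerms_le hd hA hB
  · intro p hp
    exact (Finset.mem_powersetCard.1 (Finset.mem_product.1 hp).2).2
  · intro σ
    obtain ⟨A, B, hd, hA, hB, h⟩ := hmem fun i => permOrder (σ i)
    rw [MajorityDominates, Nat.card_eq_fintype_card, Fintype.card_subtype] at h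
    obtain ⟨S, hS, hSc⟩ := Finset.exists_subset_card_eq h
    refine ⟨(⟨A, B⟩, S), Finset.mem_product.2 ⟨mem_disjointPairs.2 ⟨hd, hA, hB⟩,
      Finset.mem_powersetCard.2 ⟨Finset.subset_univ _, hSc⟩⟩, fun i hi => ?_⟩
    exact dominates_permOrder.1 (Finset.mem_filter.1 (hS hi)).2

theorem centralBinom_pow_le_of_dStarNum (j n : ℕ) :
    (2 * dStarNum (j + 1) n).choose (dStarNum (j + 1) n) ^ (2 * j) ≤
      n.choose (2 * dStarNum (j + 1) n) * 2 ^ (2 * j + 1) := by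
  classical
  set t := dStarNum (j + 1) n
  have hmem : t ∈ dStarSet (j + 1) n := (dStarNum_isGreatest _ n).1
  have key := pow_le_card_mul_pow (c := (2 * t).choose t) (w := 2) (r := 2 * j + 1)
    (m := 2 * (j + 1) - 1)
    (disjointPairs n t) (fun _ => Finset.univ)
    (fun p => precedingPerms p.1 p.2 ∪ precedingPerms p.2 p.1) ?_ ?_ ?_
  · rw [card_disjointPairs, pow_succ] at key
    have hpos : 0 < (2 * t).choose t := Nat.choose_pos (by omega)
    refine Nat.le_of_mul_le_mul_right (key.trans (le_of_eq ?_)) hpos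
    ring
  · intro p hp
    obtain ⟨hd, hA, hB⟩ := mem_disjointPairs.1 hp
    have h1 := choose_mul_card_precedingPerms_le hd hA hB
    have h2 := choose_mul_card_precedingPerms_le hd.symm hB hA
    have h3 := Nat.mul_le_mul_left ((2 * t).choose t)
      (Finset.card_union_le (precedingPerms p.1 p.2) (precedingPerms p.2 p.1))
    rw [mul_add] at h3
    omega
  · intro p _
    rw [Finset.card_univ, Fintype.card_fin]
    omega
  · intro σ
    obtain ⟨A, B, hd, hA, hB, h⟩ := hmem fun i => permOrder (σ i)
    refine ⟨⟨A, B⟩, mem_disjointPairs.2 ⟨hd, hA, hB⟩, fun i _ => Finset.mem_union.2 ?_⟩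
    exact (h i).imp dominates_permOrder.1 dominates_permOrder.1

theorem choose_le_exp_mul_div_pow (n u : ℕ) (hu : u ≠ 0) :
    (n.choose u : ℝ) ≤ (Real.exp 1 * (n / u)) ^ u := by
  have hu0 : (u : ℝ) ≠ 0 := by exact_mod_cast hu
  calc (n.choose u : ℝ) ≤ (n : ℝ) ^ u / (u.factorial : ℝ) := Nat.choose_le_pow_div u n
    _ = (n / u : ℝ) ^ u * ((u : ℝ) ^ u / u.factorial) := by
      rw [div_pow]; field_simp
    _ ≤ (n / u : ℝ) ^ u * Real.exp u := by
      gcongr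
      exact Real.pow_div_factorial_le_exp _ (by positivity) _
    _ = (Real.exp 1 * (n / u)) ^ u := by
      rw [mul_pow, ← Real.exp_nat_mul, mul_one, mul_comm]

/-- The asymptotic form of the first moment bound: comparing exponential rates,
`2 ^ j ≤ e β / 2`. -/
theorem two_pow_div_exp_le {f : ℕ → ℕ} {β : ℝ} {j D : ℕ}
    (hβ : Tendsto (fun n : ℕ => (n : ℝ) / (f n : ℝ)) atTop (𝓝 β))
    (hf : Tendsto f atTop atTop)
    (h : ∀ n, (2 * f n).choose (f n) ^ j ≤ n.choose (2 * f n) * D) :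
    (2 : ℝ) ^ (j + 1) / Real.exp 1 ≤ β := by
  by_contra! hlt
  rw [lt_div_iff₀ (Real.exp_pos 1)] at hlt
  set x : ℕ → ℝ := fun n => Real.exp 1 * ((n : ℝ) / (2 * f n : ℕ)) / 2 ^ j with hx
  have hxlim : Tendsto x atTop (𝓝 (Real.exp 1 * (β / 2) / 2 ^ j)) := by
    have : x = fun n : ℕ => Real.exp 1 * (((n : ℝ) / f n) / 2) / 2 ^ j := by
      funext n
      simp only [hx]
      push_cast
      rw [div_div, mul_comm (f n : ℝ) 2]
    rw [this]
    exact ((hβ.div_const 2).const_mul _).div_const _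
  have hρ : Real.exp 1 * (β / 2) / 2 ^ j < 1 := by
    rw [div_lt_one (by positivity)]
    rw [pow_succ] at hlt
    linarith
  obtain ⟨r, hr1, hr2⟩ := exists_between (max_lt hρ (zero_lt_one' ℝ))
  have hr0 : 0 < r := (le_max_right _ _).trans_lt hr1
  have hu : Tendsto (fun n => 2 * f n) atTop atTop :=
    tendsto_atTop_mono (fun n => by omega) hf
  have hlim : Tendsto (fun n => (D : ℝ) * (((2 * f n : ℕ) : ℝ) ^ j * r ^ (2 * f n))) atTop
      (𝓝 ((D : ℝ) * 0)) :=
    ((tendsto_pow_const_mul_const_pow_of_abs_lt_one j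
      (by rwa [abs_of_pos hr0])).comp hu).const_mul _
  rw [mul_zero] at hlim
  obtain ⟨n, h1, h2, h3⟩ := ((hlim.eventually (gt_mem_nhds zero_lt_one)).and
    ((hxlim.eventually (gt_mem_nhds ((le_max_left _ _).trans_lt hr1))).and
      (hf.eventually (eventually_ge_atTop 1)))).exists
  set u := 2 * f n with hu'
  have hu0 : (0 : ℝ) < u := by exact_mod_cast (by omega : 0 < u)
  have hx0 : 0 ≤ x n := by simp only [hx]; positivity
  have e1 : (2 : ℝ) ^ u ≤ u * (u.choose (f n) : ℝ) := by
    have := Nat.four_pow_le_two_mul_self_mul_centralBinom (f n) (by omega)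
    rw [Nat.centralBinom, show 4 = 2 ^ 2 by norm_num, ← pow_mul] at this
    exact_mod_cast this
  have e2 : ((u.choose (f n) : ℝ)) ^ j ≤ n.choose u * D := by exact_mod_cast h n
  have e3 : (n.choose u : ℝ) ≤ (x n * 2 ^ j) ^ u := by
    have h4 : x n * 2 ^ j = Real.exp 1 * (n / u) := by
      simp only [hx]
      rw [div_mul_cancel₀ _ (by positivity)]
    rw [h4]
    exact choose_le_exp_mul_div_pow n u (by omega)
  have e4 : ((2 : ℝ) ^ j) ^ u ≤ ((D : ℝ) * ((u : ℝ) ^ j * r ^ u)) * ((2 : ℝ) ^ j) ^ u := by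
    calc ((2 : ℝ) ^ j) ^ u = ((2 : ℝ) ^ u) ^ j := by rw [← pow_mul, ← pow_mul, mul_comm]
      _ ≤ (u * (u.choose (f n) : ℝ)) ^ j := by gcongr
      _ = (u : ℝ) ^ j * (u.choose (f n) : ℝ) ^ j := mul_pow _ _ _
      _ ≤ (u : ℝ) ^ j * ((x n * 2 ^ j) ^ u * D) := by
        gcongr
        exact e2.trans (by gcongr)
      _ ≤ (u : ℝ) ^ j * ((r * 2 ^ j) ^ u * D) := by gcongr
      _ = _ := by rw [mul_pow]; ring
  have hp : (0 : ℝ) < ((2 : ℝ) ^ j) ^ u := by positivity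
  nlinarith

/-! ### Tournaments from affine planes -/

section AffinePlane

variable {q : ℕ} [Fact q.Prime]

/-- The intercept of the line of slope `s` through `u`. -/
def intercept (s : ZMod q) (u : ZMod q × ZMod q) : ZMod q := u.2 - s * u.1

theorem intercept_ext {s s' : ZMod q} {u v : ZMod q × ZMod q} (hs : s ≠ s')
    (h : intercept s u = intercept s v) (h' : intercept s' u = intercept s' v) : u = v := by
  simp only [intercept] at h h'
  have h1 : (s - s') * (u.1 - v.1) = 0 := by linear_combination h' - h
  have h2 : u.1 = v.1 := by
    rcases mul_eq_zero.1 h1 with h1 | h1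
    · exact absurd (sub_eq_zero.1 h1) hs
    · exact sub_eq_zero.1 h1
  refine Prod.ext h2 ?_
  rw [h2] at h
  linear_combination h

/-- The (non-vertical) lines meeting `A`, each given by its slope and intercept. -/
def linesMeeting (A : Finset (ZMod q × ZMod q)) : Finset (ZMod q × ZMod q) :=
  Finset.univ.filter fun l => ∃ a ∈ A, intercept l.1 a = l.2

/-- By Cauchy–Schwarz, as two points lie on at most one common line. -/
theorem two_mul_sq_le_card_linesMeeting {A : Finset (ZMod q × ZMod q)} (hA : A.card = 2 * q) :
    2 * q ^ 2 ≤ 3 * (linesMeeting A).card := by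
  classical
  have hq : 0 < q := (Fact.out : q.Prime).pos
  let deg : ZMod q × ZMod q → ℕ := fun l => (A.filter fun a => intercept l.1 a = l.2).card
  have hsum : ∑ l ∈ linesMeeting A, deg l = 2 * q * q := by
    have h1 : ∑ l ∈ linesMeeting A, deg l = ∑ l : ZMod q × ZMod q, deg l := by
      refine Finset.sum_subset (Finset.subset_univ _) fun l _ hl => ?_
      refine Finset.card_eq_zero.2 (Finset.filter_eq_empty_iff.2 fun a ha h => hl ?_)
      exact Finset.mem_filter.2 ⟨Finset.mem_univ _, a, ha, h⟩
    rw [h1, Fintype.sum_prod_type]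
    have h2 : ∀ s : ZMod q, ∑ c, deg (s, c) = 2 * q := fun s => by
      rw [← hA]
      exact (Finset.card_eq_sum_card_fiberwise (f := intercept s) (t := Finset.univ)
        fun _ _ => Finset.mem_univ _).symm
    simp only [h2, Finset.sum_const, Finset.card_univ, ZMod.card, smul_eq_mul]
    ring
  have hsq : ∑ l ∈ linesMeeting A, deg l ^ 2 ≤ 6 * q ^ 2 := by
    let E : ZMod q → Finset ((ZMod q × ZMod q) × (ZMod q × ZMod q)) := fun s =>
      A.offDiag.filter fun p => intercept s p.1 = intercept s p.2
    have h1 : ∀ s : ZMod q, ∑ c, deg (s, c) ^ 2 = A.card + (E s).card := by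
      intro s
      have h2 : ∀ c, deg (s, c) ^ 2 = ((A ×ˢ A).filter fun p =>
          intercept s p.1 = c ∧ intercept s p.2 = c).card := by
        intro c
        rw [sq, ← Finset.card_product, ← Finset.filter_product]
      have h3 : ∑ c, deg (s, c) ^ 2 =
          ((A ×ˢ A).filter fun p => intercept s p.1 = intercept s p.2).card := by
        rw [Finset.card_eq_sum_card_fiberwise (f := fun p => intercept s p.1)
          (t := Finset.univ) fun _ _ => Finset.mem_univ _]
        refine Finset.sum_congr rfl fun c _ => ?_
        rw [h2, Finset.filter_filter]
        congr 1
        ext p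
        simp only [Finset.mem_filter]
        grind
      rw [h3, ← Finset.diag_union_offDiag, Finset.filter_union,
        Finset.card_union_of_disjoint
          (Finset.disjoint_filter_filter (Finset.disjoint_diag_offDiag A)),
        Finset.filter_true_of_mem, Finset.diag_card]
      intro p hp
      rw [(Finset.mem_diag.1 hp).2]
    have h4 : ∑ s, (E s).card ≤ (2 * q) ^ 2 := by
      have hdisj : ((Finset.univ : Finset (ZMod q)) : Set (ZMod q)).PairwiseDisjoint E := by
        intro s _ s' _ hss
        refine Finset.disjoint_left.2 fun p h h' => ?_
        obtain ⟨hp, h⟩ := Finset.mem_filter.1 h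
        exact (Finset.mem_offDiag.1 hp).2.2 (intercept_ext hss h (Finset.mem_filter.1 h').2)
      rw [← Finset.card_biUnion hdisj]
      calc _ ≤ (A ×ˢ A).card := Finset.card_le_card (Finset.biUnion_subset.2 fun s _ p hp => by
              have := Finset.mem_offDiag.1 (Finset.mem_filter.1 hp).1
              exact Finset.mem_product.2 ⟨this.1, this.2.1⟩)
        _ = _ := by rw [Finset.card_product, hA, sq]
    calc ∑ l ∈ linesMeeting A, deg l ^ 2 ≤ ∑ l : ZMod q × ZMod q, deg l ^ 2 :=
          Finset.sum_le_sum_of_subset (Finset.subset_univ _)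
      _ = q * (2 * q) + ∑ s, (E s).card := by
          rw [Fintype.sum_prod_type]
          simp only [h1, Finset.sum_add_distrib, Finset.sum_const, Finset.card_univ, ZMod.card,
            smul_eq_mul, hA]
      _ ≤ q * (2 * q) + (2 * q) ^ 2 := Nat.add_le_add_left h4 _
      _ = 6 * q ^ 2 := by ring
  have hcs := sq_sum_le_card_mul_sum_sq (s := linesMeeting A) (f := deg)
  rw [hsum] at hcs
  have h5 : (2 * q * q) ^ 2 ≤ (linesMeeting A).card * (6 * q ^ 2) :=
    hcs.trans (Nat.mul_le_mul_left _ hsq)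
  refine Nat.le_of_mul_le_mul_right (?_ : 2 * q ^ 2 * (2 * q ^ 2) ≤ _)
    (by positivity : 0 < 2 * q ^ 2)
  calc 2 * q ^ 2 * (2 * q ^ 2) = (2 * q * q) ^ 2 := by ring
    _ ≤ (linesMeeting A).card * (6 * q ^ 2) := h5
    _ = _ := by ring

theorem sq_le_card_linesMeeting_inter {A B : Finset (ZMod q × ZMod q)} (hA : A.card = 2 * q)
    (hB : B.card = 2 * q) : q ^ 2 ≤ 3 * (linesMeeting A ∩ linesMeeting B).card := by
  classical
  have h1 := two_mul_sq_le_card_linesMeeting hA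
  have h2 := two_mul_sq_le_card_linesMeeting hB
  have h3 := Finset.card_union_add_card_inter (linesMeeting A) (linesMeeting B)
  have h4 := Finset.card_le_univ (linesMeeting A ∪ linesMeeting B)
  rw [Fintype.card_prod, ZMod.card, ← sq] at h4
  omega

/-- The position of a point on its line of slope `s`; the sign `ε` of the line says which way the
line is run through. -/
def linePos (ε : ZMod q × ZMod q → Bool) (s : ZMod q) (u : ZMod q × ZMod q) : ℤ :=
  if ε (s, intercept s u) then (u.1.val : ℤ) else q - 1 - u.1.val

theorem linePos_nonneg (ε : ZMod q × ZMod q → Bool) (s : ZMod q) (u : ZMod q × ZMod q) :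
    0 ≤ linePos ε s u := by
  have := u.1.val_lt
  simp only [linePos]
  split_ifs <;> omega

theorem linePos_lt (ε : ZMod q × ZMod q → Bool) (s : ZMod q) (u : ZMod q × ZMod q) :
    linePos ε s u < q := by
  have := u.1.val_lt
  simp only [linePos]
  split_ifs <;> omega

theorem eq_of_linePos_eq {ε : ZMod q × ZMod q → Bool} {s : ZMod q} {u v : ZMod q × ZMod q}
    (hc : intercept s u = intercept s v) (h : linePos ε s u = linePos ε s v) : u = v := by
  have h1 : u.1 = v.1 := by
    apply ZMod.val_injective q
    simp only [linePos, hc] at h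
    split_ifs at h <;> omega
  refine Prod.ext h1 ?_
  simp only [intercept, h1] at hc
  linear_combination hc

/-- The position of a point in the `b`-th order of slope `s`: the lines of slope `s` follow each
other by intercept, increasing in one of the two orders and decreasing in the other, while each
line is run through in the same way in both. -/
def slopePos (ε : ZMod q × ZMod q → Bool) (s : ZMod q) (b : Bool) (u : ZMod q × ZMod q) : ℤ :=
  (if b then 1 else -1) * (q * ((intercept s u).val : ℤ)) + linePos ε s u

theorem slopePos_lt_of_lt {ε : ZMod q × ZMod q → Bool} {s : ZMod q} {u v : ZMod q × ZMod q}
    (h : (intercept s u).val < (intercept s v).val) :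
    slopePos ε s true u < slopePos ε s true v ∧ slopePos ε s false v < slopePos ε s false u := by
  have h1 := linePos_nonneg ε s u
  have h2 := linePos_lt ε s u
  have h3 := linePos_nonneg ε s v
  have h4 := linePos_lt ε s v
  have h5 : (q : ℤ) * (((intercept s u).val : ℤ) + 1) ≤ q * ((intercept s v).val : ℤ) := by
    gcongr
    omega
  rw [mul_add, mul_one] at h5
  simp only [slopePos]
  simp only [if_true, Bool.false_eq_true, if_false]
  constructor <;> linarith

theorem slopePos_injective (ε : ZMod q × ZMod q → Bool) (s : ZMod q) (b : Bool) :
    Function.Injective (slopePos ε s b) := by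
  intro u v h
  have hc : intercept s u = intercept s v := by
    apply ZMod.val_injective q
    by_contra hne
    rcases lt_or_gt_of_ne hne with hlt | hlt
    · have := slopePos_lt_of_lt (ε := ε) hlt
      cases b <;> omega
    · have := slopePos_lt_of_lt (ε := ε) hlt
      cases b <;> omega
  refine eq_of_linePos_eq (ε := ε) hc ?_
  simpa [slopePos, hc] using h

/-- The position of a point in the `i`-th order. The orders `2 s` and `2 s + 1` with `s < q` are
those of slope `s`. The remaining ones are alternately some fixed order and its reverse. -/
def planePos (ε : ZMod q × ZMod q → Bool) (i : ℕ) (u : ZMod q × ZMod q) : ℤ :=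
  if i / 2 < q then slopePos ε ((i / 2 : ℕ) : ZMod q) (decide (i % 2 = 0)) u
  else if i % 2 = 0 then slopePos ε 0 true u else - slopePos ε 0 true u

theorem planePos_injective (ε : ZMod q × ZMod q → Bool) (i : ℕ) :
    Function.Injective (planePos ε i) := by
  unfold planePos
  split_ifs
  · exact slopePos_injective ε _ _
  · exact slopePos_injective ε _ _
  · exact neg_injective.comp (slopePos_injective ε _ _)

/-- The `2k - 1` orders on the affine plane given by a sign for each line. -/
abbrev planeOrders (k : ℕ) (ε : ZMod q × ZMod q → Bool) (i : Fin (2 * k - 1)) :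
    LinearOrder (ZMod q × ZMod q) :=
  LinearOrder.lift' (planePos ε i) (planePos_injective ε i)

/-- Two orders whose indices form a pair `{2 j, 2 j + 1}` agree on two points only if the points
lie on a line of slope `j`; so that line decides the majority. -/
theorem linePos_lt_of_adj {k : ℕ} (hqk : q + 1 ≤ k) {ε : ZMod q × ZMod q → Bool} {s : ZMod q}
    {u v : ZMod q × ZMod q} (hc : intercept s u = intercept s v)
    (h : (majorityTournament k (planeOrders k ε)).Adj u v) : linePos ε s u < linePos ε s v := by
  classical
  by_contra! hle
  simp only [majorityTournament, Nat.card_eq_fintype_card, Fintype.card_subtype] at h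
  set I := Finset.univ.filter fun i : Fin (2 * k - 1) => (planeOrders k ε i).lt u v with hI
  have hmem : ∀ i ∈ I, planePos ε i u < planePos ε i v := fun i hi => (Finset.mem_filter.1 hi).2
  have hne : u ≠ v := by
    rintro rfl
    obtain ⟨i, hi⟩ : I.Nonempty := by rw [← Finset.card_pos]; omega
    exact lt_irrefl _ (hmem i hi)
  have hsval : s.val < q := s.val_lt
  -- The index `s.val` is missed, as the two orders of slope `s` both place `v` before `u`.
  have hs : ∀ i ∈ I, (i : ℕ) / 2 ≠ s.val := by
    intro i hi his
    have h1 := hmem i hi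
    simp only [planePos, his, hsval, if_true, ZMod.natCast_val, ZMod.cast_id', id_eq, slopePos,
      hc] at h1
    linarith
  have hinj : ∀ i ∈ I, ∀ j ∈ I, (i : ℕ) / 2 = (j : ℕ) / 2 → (i : ℕ) % 2 = 0 → (j : ℕ) % 2 = 0 := by
    intro i hi j hj hij hi2
    by_contra hj2
    have h1 := hmem i hi
    have h2 := hmem j hj
    simp only [planePos, ← hij, hi2, hj2, if_true, if_false, decide_true, decide_false] at h1 h2
    split_ifs at h1 h2 with hq
    · have hss : ((i / 2 : ℕ) : ZMod q) ≠ s := by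
        intro e
        apply hs i hi
        rw [← e, ZMod.val_natCast_of_lt hq]
      have hcne : intercept ((i / 2 : ℕ) : ZMod q) u ≠ intercept ((i / 2 : ℕ) : ZMod q) v :=
        fun e => hne (intercept_ext hss e hc)
      rcases lt_or_gt_of_ne fun e => hcne (ZMod.val_injective q e) with hlt | hlt
      · have := slopePos_lt_of_lt (ε := ε) hlt
        omega
      · have := slopePos_lt_of_lt (ε := ε) hlt
        omega
    · omega
  have hcard : I.card ≤ ((Finset.range k).erase s.val).card := by
    refine Finset.card_le_card_of_injOn (fun i => (i : ℕ) / 2) ?_ ?_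
    · intro i hi
      refine Finset.mem_coe.2 (Finset.mem_erase.2 ⟨hs i hi, Finset.mem_range.2 ?_⟩)
      have := i.isLt
      dsimp only
      omega
    · intro i hi j hj hij
      have h1 := hinj i hi j hj hij
      have h2 := hinj j hj i hi hij.symm
      dsimp only at hij
      exact Fin.ext (by omega)
  rw [Finset.card_erase_of_mem (Finset.mem_range.2 (by omega)), Finset.card_range] at hcard
  omega

/-- For fixed `A` and `B`, each line meeting both of them forces its sign. -/
theorem card_signs_le (k : ℕ) (hqk : q + 1 ≤ k) {A B : Finset (ZMod q × ZMod q)}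
    (hA : A.card = 2 * q) (hB : B.card = 2 * q)
    (S : Finset (ZMod q × ZMod q → Bool))
    (hS : ∀ ε ∈ S, MajorityPrecedes k (planeOrders k ε) A B) :
    S.card ^ 3 * 2 ^ (q ^ 2) ≤ 2 ^ (3 * q ^ 2) := by
  classical
  set M := linesMeeting A ∩ linesMeeting B
  have hforce : ∀ l ∈ M, ∀ ε ∈ S, ∀ ε' ∈ S, ε l = ε' l := by
    intro l hl ε hε ε' hε'
    obtain ⟨h1, h2⟩ := Finset.mem_inter.1 hl
    obtain ⟨a, ha, hal⟩ := (Finset.mem_filter.1 h1).2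
    obtain ⟨b, hb, hbl⟩ := (Finset.mem_filter.1 h2).2
    have e1 := linePos_lt_of_adj hqk (hal.trans hbl.symm) (hS ε hε a ha b hb)
    have e2 := linePos_lt_of_adj hqk (hal.trans hbl.symm) (hS ε' hε' a ha b hb)
    simp only [linePos, hal, hbl] at e1 e2
    by_contra hne
    cases h : ε l <;> cases h' : ε' l <;> simp_all <;> omega
  rcases S.eq_empty_or_nonempty with rfl | ⟨ε₀, hε₀⟩
  · simp
  have hsub : S ⊆ Fintype.piFinset fun l => if l ∈ M then {ε₀ l} else Finset.univ := by
    intro ε hε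
    refine Fintype.mem_piFinset.2 fun l => ?_
    by_cases hl : l ∈ M
    · simp [hl, hforce l hl ε hε ε₀ hε₀]
    · simp [hl]
  have hcard : S.card * 2 ^ M.card ≤ 2 ^ (q ^ 2) := by
    have h1 := Finset.card_le_card hsub
    rw [Fintype.card_piFinset] at h1
    have h2 : ∀ l, (if l ∈ M then {ε₀ l} else Finset.univ : Finset Bool).card =
        if l ∈ M then 1 else 2 := fun l => by split_ifs <;> simp
    simp only [h2] at h1
    rw [Finset.prod_ite, Finset.prod_const, Finset.prod_const, one_pow, one_mul] at h1
    have h3 : (Finset.univ.filter fun l => l ∉ M) = Mᶜ := by ext; simp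
    rw [h3, Finset.card_compl, Fintype.card_prod, ZMod.card, ← sq] at h1
    have h4 : M.card ≤ q ^ 2 := by
      have := Finset.card_le_univ M
      rwa [Fintype.card_prod, ZMod.card, ← sq] at this
    calc S.card * 2 ^ M.card ≤ 2 ^ (q ^ 2 - M.card) * 2 ^ M.card := Nat.mul_le_mul_right _ h1
      _ = 2 ^ (q ^ 2) := by rw [← pow_add, Nat.sub_add_cancel h4]
  have hM : q ^ 2 ≤ 3 * M.card := sq_le_card_linesMeeting_inter hA hB
  calc S.card ^ 3 * 2 ^ (q ^ 2) ≤ S.card ^ 3 * 2 ^ (3 * M.card) :=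
        Nat.mul_le_mul_left _ (Nat.pow_le_pow_right (by norm_num) hM)
    _ = (S.card * 2 ^ M.card) ^ 3 := by rw [mul_pow, ← pow_mul, mul_comm 3]
    _ ≤ (2 ^ (q ^ 2)) ^ 3 := Nat.pow_le_pow_left hcard 3
    _ = 2 ^ (3 * q ^ 2) := by rw [← pow_mul, mul_comm]

/-- For some choice of the signs there are no two sets of size `2q`: there are `2 ^ (q ^ 2)`
choices, and each of the at most `q ^ (8 q)` pairs of sets rules out at most
`2 ^ (2 q ^ 2 / 3)` of them. -/
theorem exists_signs (hq : q ^ 24 < 2 ^ q) {k : ℕ} (hqk : q + 1 ≤ k) :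
    ∃ ε : ZMod q × ZMod q → Bool, ∀ A B : Finset (ZMod q × ZMod q),
      A.card = 2 * q → B.card = 2 * q → ¬ MajorityPrecedes k (planeOrders k ε) A B := by
  classical
  by_contra! hcon
  let P : Finset (Finset (ZMod q × ZMod q) × Finset (ZMod q × ZMod q)) :=
    Finset.powersetCard (2 * q) Finset.univ ×ˢ Finset.powersetCard (2 * q) Finset.univ
  let S : Finset (ZMod q × ZMod q) × Finset (ZMod q × ZMod q) → Finset (ZMod q × ZMod q → Bool) :=
    fun p => Finset.univ.filter fun ε => MajorityPrecedes k (planeOrders k ε) p.1 p.2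
  have hcover : (Finset.univ : Finset (ZMod q × ZMod q → Bool)) ⊆ P.biUnion S := by
    intro ε _
    obtain ⟨A, B, hA, hB, h⟩ := hcon ε
    refine Finset.mem_biUnion.2 ⟨(A, B), Finset.mem_product.2 ⟨?_, ?_⟩, ?_⟩
    · exact Finset.mem_powersetCard.2 ⟨Finset.subset_univ _, hA⟩
    · exact Finset.mem_powersetCard.2 ⟨Finset.subset_univ _, hB⟩
    · exact Finset.mem_filter.2 ⟨Finset.mem_univ _, h⟩
  have hP : P.card ≤ q ^ (8 * q) := by
    have h1 : (q ^ 2).choose (2 * q) ≤ (q ^ 2) ^ (2 * q) := Nat.choose_le_pow _ _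
    rw [Finset.card_product, Finset.card_powersetCard, Finset.card_univ, Fintype.card_prod,
      ZMod.card, ← sq q]
    calc _ ≤ (q ^ 2) ^ (2 * q) * (q ^ 2) ^ (2 * q) := Nat.mul_le_mul h1 h1
      _ = q ^ (8 * q) := by rw [← pow_mul, ← pow_add]; ring_nf
  -- Some pair is responsible for at least the average number of choices.
  have hne : P.Nonempty := by
    obtain ⟨p, hp, -⟩ := Finset.mem_biUnion.1 (hcover (Finset.mem_univ fun _ => true))
    exact ⟨p, hp⟩
  obtain ⟨p, hp, hmax⟩ := Finset.exists_max_image P (fun p => (S p).card) hne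
  have h1 : 2 ^ (q ^ 2) ≤ q ^ (8 * q) * (S p).card := by
    have h2 := (Finset.card_le_card hcover).trans Finset.card_biUnion_le
    rw [Finset.card_univ, Fintype.card_fun, Fintype.card_bool, Fintype.card_prod, ZMod.card,
      ← sq] at h2
    calc 2 ^ (q ^ 2) ≤ ∑ p ∈ P, (S p).card := h2
      _ ≤ P.card * (S p).card := by
        simpa [mul_comm] using Finset.sum_le_card_nsmul P _ _ hmax
      _ ≤ _ := Nat.mul_le_mul_right _ hP
  have h3 := card_signs_le k hqk
    (Finset.mem_powersetCard.1 (Finset.mem_product.1 hp).1).2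
    (Finset.mem_powersetCard.1 (Finset.mem_product.1 hp).2).2 (S p)
    fun ε hε => (Finset.mem_filter.1 hε).2
  have h4 : 2 ^ (q ^ 2) ≤ (q ^ 24) ^ q := by
    refine Nat.le_of_mul_le_mul_right (?_ : _ * 2 ^ (3 * q ^ 2) ≤ _)
      (by positivity : 0 < 2 ^ (3 * q ^ 2))
    calc 2 ^ (q ^ 2) * 2 ^ (3 * q ^ 2) = (2 ^ (q ^ 2)) ^ 3 * 2 ^ (q ^ 2) := by
          rw [← pow_mul, mul_comm, mul_comm 3]
      _ ≤ (q ^ (8 * q) * (S p).card) ^ 3 * 2 ^ (q ^ 2) :=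
          Nat.mul_le_mul_right _ (Nat.pow_le_pow_left h1 3)
      _ = (q ^ 24) ^ q * ((S p).card ^ 3 * 2 ^ (q ^ 2)) := by
          rw [mul_pow, ← pow_mul, ← pow_mul, mul_assoc]; ring_nf
      _ ≤ (q ^ 24) ^ q * 2 ^ (3 * q ^ 2) := Nat.mul_le_mul_left _ h3
  have h5 : (q ^ 24) ^ q < (2 ^ q) ^ q :=
    Nat.pow_lt_pow_left hq (Fact.out : q.Prime).ne_zero
  rw [← pow_mul 2, ← sq] at h5
  omega

theorem bNum_sq_lt (hq : q ^ 24 < 2 ^ q) {k : ℕ} (hqk : q + 1 ≤ k) : bNum k (q ^ 2) < 2 * q := by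
  obtain ⟨ε, hε⟩ := exists_signs hq hqk
  rw [bNum_eq]
  refine (isPairRelation_majorityPrecedes (by omega)).maxPair_lt (V := ZMod q × ZMod q)
    (by rw [Fintype.card_prod, ZMod.card, sq]) (planeOrders k ε) fun A B _ hA hB => hε A B hA hB

end AffinePlane

theorem exists_forall_pow_lt_two_pow : ∃ N : ℕ, ∀ q : ℕ, N ≤ q → q ^ 24 < 2 ^ q := by
  have h := (tendsto_pow_const_div_const_pow_of_one_lt 24 (one_lt_two : (1 : ℝ) < 2)).eventually
    (gt_mem_nhds zero_lt_one)
  obtain ⟨N, hN⟩ := eventually_atTop.1 h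
  refine ⟨N, fun q hq => ?_⟩
  have := hN q hq
  rw [div_lt_one (by positivity)] at this
  exact_mod_cast this

/-- Bertrand's postulate supplies a prime `q` of the order of `k`. -/
theorem exists_linear_lower_bound : ∃ c : ℝ, 0 < c ∧ ∀ (k : ℕ) (β : ℝ), 1 ≤ k → 1 ≤ β →
    (∀ m : ℕ, (m : ℝ) ≤ β * (bNum k m + 1)) → c * k ≤ β := by
  obtain ⟨N, hN⟩ := exists_forall_pow_lt_two_pow
  refine ⟨1 / (2 * N + 16), by positivity, fun k β hk hβ h => ?_⟩
  rw [one_div_mul_eq_div, div_le_iff₀ (by positivity)]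
  rcases le_or_gt k (2 * N + 16) with hle | hgt
  · have h1 : (k : ℝ) ≤ 2 * N + 16 := by exact_mod_cast hle
    nlinarith
  · obtain ⟨q, hq, hlt, hle⟩ := Nat.exists_prime_lt_and_le_two_mul ((k - 1) / 2) (by omega)
    have : Fact q.Prime := ⟨hq⟩
    have h1 := bNum_sq_lt (hN q (by omega)) (k := k) (by omega)
    have h2 := h (q ^ 2)
    have hq0 : (0 : ℝ) < q := by exact_mod_cast hq.pos
    have h3 : (bNum k (q ^ 2) : ℝ) + 1 ≤ 2 * q := by exact_mod_cast h1
    have h4 : ((q : ℝ)) * q ≤ (2 * β) * q := by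
      push_cast at h2
      nlinarith
    have h5 : (q : ℝ) ≤ 2 * β := le_of_mul_le_mul_right h4 hq0
    have h6 : (k : ℝ) ≤ 4 * q := by exact_mod_cast (by omega : k ≤ 4 * q)
    have h7 : (0 : ℝ) ≤ N := by positivity
    nlinarith

/-! ### Two of three coordinates -/

/-- At least two of the three propositions `P 0`, `P 1`, `P 2` hold. -/
def TwoOfThree (P : Fin 3 → Prop) : Prop := ∀ k l, k ≠ l → P k ∨ P l

theorem TwoOfThree.of_two_le_card {P : Fin 3 → Prop} (h : 2 ≤ Nat.card {i // P i}) :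
    TwoOfThree P := by
  classical
  intro k l hkl
  by_contra! hcon
  rw [Nat.subtype_card (Finset.univ.filter P) (by simp)] at h
  have hsub : (Finset.univ.filter P) ⊆ ({k, l} : Finset (Fin 3))ᶜ := by
    intro i hi
    have := (Finset.mem_filter.1 hi).2
    simp only [Finset.mem_compl, Finset.mem_insert, Finset.mem_singleton, not_or]
    exact ⟨fun e => hcon.1 (e ▸ this), fun e => hcon.2 (e ▸ this)⟩
  have := Finset.card_le_card hsub
  rw [Finset.card_compl, Finset.card_pair hkl, Fintype.card_fin] at this
  omega

theorem TwoOfThree.of_two {P : Fin 3 → Prop} {k l : Fin 3} (hkl : k ≠ l) (hk : P k) (hl : P l) :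
    TwoOfThree P := by
  intro i j hij
  have : i = k ∨ i = l ∨ j = k ∨ j = l := by omega
  rcases this with rfl | rfl | rfl | rfl <;> tauto

/-- Suppose that among any points above (or below) a given point in two coordinates there are at
most `m`. If `B` has more than `m` points and `A k` precedes `B` in coordinate `k`, then `B` and
the three sets `A k` are almost disjoint: a point that is below `B` in two coordinates does not
exist. -/
theorem card_add_sum_card_le {W : Type} [Fintype W] {m : ℕ} {p : Fin 3 → W → ℤ}
    (hinj : ∀ k, Function.Injective (p k))
    (H : ∀ (x : W) (k l : Fin 3), k ≠ l → ∀ S : Finset W,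
      (∀ b ∈ S, p k x < p k b ∧ p l x < p l b) → S.card ≤ m)
    {A : Fin 3 → Finset W} {B : Finset W} (hAB : ∀ k, ∀ a ∈ A k, ∀ b ∈ B, p k a ≤ p k b)
    (hB : m < B.card) : B.card + ∑ k, (A k).card ≤ Fintype.card W + 3 := by
  classical
  -- The points of `A k` strictly below `B`: all of them but one.
  let A' : Fin 3 → Finset W := fun k => (A k).filter fun x => ∀ b ∈ B, p k x < p k b
  have hA' : ∀ k, (A k).card ≤ (A' k).card + 1 := by
    intro k
    rw [← Finset.card_filter_add_card_filter_not (s := A k) fun x => ∀ b ∈ B, p k x < p k b]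
    refine Nat.add_le_add_left (Finset.card_le_one.2 fun x hx y hy => ?_) _
    simp only [Finset.mem_filter, not_forall, not_lt] at hx hy
    obtain ⟨hxA, b, hb, hxb⟩ := hx
    obtain ⟨hyA, c, hc, hyc⟩ := hy
    have h1 := hAB k x hxA c hc
    have h2 := hAB k y hyA b hb
    exact hinj k (by omega)
  have hdisj : ∀ k l, k ≠ l → Disjoint (A' k) (A' l) := by
    intro k l hkl
    refine Finset.disjoint_left.2 fun x hk hl => ?_
    have := H x k l hkl B fun b hb => ⟨(Finset.mem_filter.1 hk).2 b hb,
      (Finset.mem_filter.1 hl).2 b hb⟩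
    omega
  have hdisjB : Disjoint B (Finset.univ.biUnion A') := by
    refine Finset.disjoint_left.2 fun x hx hx' => ?_
    obtain ⟨k, -, hk⟩ := Finset.mem_biUnion.1 hx'
    exact lt_irrefl _ ((Finset.mem_filter.1 hk).2 x hx)
  have h1 := Finset.card_le_univ (B ∪ Finset.univ.biUnion A')
  rw [Finset.card_union_of_disjoint hdisjB,
    Finset.card_biUnion fun k _ l _ hkl => hdisj k l hkl] at h1
  have h2 : ∑ k, (A k).card ≤ ∑ k, ((A' k).card + 1) := Finset.sum_le_sum fun k _ => hA' k
  rw [Finset.sum_add_distrib] at h2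
  simp only [Finset.sum_const, Finset.card_univ, Fintype.card_fin, smul_eq_mul, mul_one] at h2
  omega

/-! ### The points of a single cell -/

section Cell

variable {m : ℕ}

/-- The three coordinates of the points of a cell. The points lie on two segments of a plane on
which the coordinates have constant sum; up to rounding these are, in units of `4 m`,
`(t, 1 - t / 2, (1 - t) / 2)` and `(t, (1 - t) / 2, 1 - t / 2)` with `0 ≤ t < 1`. -/
def cellPos (k : Fin 3) (x : Bool × Fin m) : ℤ :=
  if x.1 then ![4 * (x.2 : ℤ), 4 * m - 1 - 2 * (x.2 : ℤ), 2 * m - 1 - 2 * (x.2 : ℤ)] k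
  else ![4 * (x.2 : ℤ) + 2, 2 * m - 2 - 2 * (x.2 : ℤ), 4 * m - 2 - 2 * (x.2 : ℤ)] k

theorem cellPos_injective (k : Fin 3) : Function.Injective (cellPos (m := m) k) := by
  rintro ⟨b, u⟩ ⟨c, v⟩ h
  have hu := u.isLt
  have hv := v.isLt
  have : b = c ∧ (u : ℕ) = v := by
    fin_cases k <;> cases b <;> cases c <;> simp [cellPos] at h ⊢ <;> omega
  exact Prod.ext this.1 (Fin.ext this.2)

theorem cellPos_nonneg (k : Fin 3) (x : Bool × Fin m) : 0 ≤ cellPos k x := by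
  obtain ⟨b, u⟩ := x
  have hu := u.isLt
  fin_cases k <;> cases b <;> simp [cellPos] <;> omega

theorem cellPos_lt (k : Fin 3) (x : Bool × Fin m) : cellPos k x < 4 * m := by
  obtain ⟨b, u⟩ := x
  have hu := u.isLt
  fin_cases k <;> cases b <;> simp [cellPos] <;> omega

theorem sum_cellPos (x : Bool × Fin m) :
    cellPos 0 x + cellPos 1 x + cellPos 2 x = 6 * m - 2 := by
  obtain ⟨b, u⟩ := x
  cases b <;> simp [cellPos] <;> ring

theorem card_eq_zero_or_card_add_le (S : Finset (Fin m)) :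
    S.card = 0 ∨ ∃ lo ∈ S, ∃ hi ∈ S, S.card + (lo : ℕ) ≤ (hi : ℕ) + 1 := by
  rcases S.eq_empty_or_nonempty with h | h
  · exact Or.inl (Finset.card_eq_zero.2 h)
  refine Or.inr ⟨S.min' h, S.min'_mem h, S.max' h, S.max'_mem h, ?_⟩
  have hsub : S ⊆ Finset.Icc (S.min' h) (S.max' h) := fun x hx =>
    Finset.mem_Icc.2 ⟨S.min'_le x hx, S.le_max' x hx⟩
  have := Finset.card_le_card hsub
  rw [Fin.card_Icc] at this
  have hle : S.min' h ≤ S.max' h := S.min'_le _ (S.max'_mem h)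
  have hle' : (S.min' h : ℕ) ≤ S.max' h := hle
  omega

/-- Within a cell, a set and the points it precedes fill at most half of the cell, up to
rounding. -/
theorem card_add_card_le_of_cell {A B : Finset (Bool × Fin m)} (hA : A.Nonempty)
    (hB : B.Nonempty) (h : ∀ a ∈ A, ∀ b ∈ B, TwoOfThree fun k => cellPos k a < cellPos k b) :
    A.card + B.card ≤ m + 1 := by
  classical
  let s : Finset (Bool × Fin m) → Bool → Finset (Fin m) := fun S b =>
    Finset.univ.filter fun u => (b, u) ∈ S
  have hmem : ∀ S b u, u ∈ s S b ↔ (b, u) ∈ S := by simp [s]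
  have hcard : ∀ S, S.card = (s S true).card + (s S false).card := by
    intro S
    have h1 : S = ((Finset.univ : Finset Bool).sigma (s S)).map
        (Equiv.sigmaEquivProd _ _).toEmbedding := by
      ext ⟨b, u⟩
      simp [s]
    conv_lhs => rw [h1]
    rw [Finset.card_map, Finset.card_sigma, Fintype.sum_bool]
  have hbeat : ∀ b u c v, u ∈ s A b → v ∈ s B c →
      (b = c → v < u) ∧ (b = true → c = false → u ≤ v) ∧ (b = false → c = true → u < v) := by
    intro b u c v hu hv
    have h0 := h _ ((hmem _ _ _).1 hu) _ ((hmem _ _ _).1 hv)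
    have h01 := h0 0 1 (by decide)
    have h02 := h0 0 2 (by decide)
    have h12 := h0 1 2 (by decide)
    have hu' := u.isLt
    have hv' := v.isLt
    simp only [Fin.lt_def, Fin.le_def]
    cases b <;> cases c <;> simp [cellPos] at h01 h02 h12 ⊢ <;> omega
  have hAc := hcard A
  have hBc := hcard B
  have hA1 := Finset.card_pos.2 hA
  have hB1 := Finset.card_pos.2 hB
  rw [hAc] at hA1
  rw [hBc] at hB1
  rw [hAc, hBc]
  have key : ∀ b c, ∀ u ∈ s A b, ∀ v ∈ s B c, (b = c → (v : ℕ) < u) ∧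
      (b = true → c = false → (u : ℕ) ≤ v) ∧ (b = false → c = true → (u : ℕ) < v) :=
    fun b c u hu v hv => hbeat b u c v hu hv
  have k11 := fun u hu v hv => (key true true u hu v hv).1 rfl
  have k00 := fun u hu v hv => (key false false u hu v hv).1 rfl
  have k10 := fun u hu v hv => (key true false u hu v hv).2.1 rfl rfl
  have k01 := fun u hu v hv => (key false true u hu v hv).2.2 rfl rfl
  clear key hbeat hAc hBc hcard hmem h hA hB
  rcases card_eq_zero_or_card_add_le (s A true) with e1 | ⟨l1, hl1, r1, hr1, c1⟩ <;>
  rcases card_eq_zero_or_card_add_le (s A false) with e2 | ⟨l2, hl2, r2, hr2, c2⟩ <;>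
  rcases card_eq_zero_or_card_add_le (s B true) with e3 | ⟨l3, hl3, r3, hr3, c3⟩ <;>
  rcases card_eq_zero_or_card_add_le (s B false) with e4 | ⟨l4, hl4, r4, hr4, c4⟩ <;>
  first
  | omega
  | (try have f1 := k11 l1 hl1 r3 hr3
     try have f2 := k00 l2 hl2 r4 hr4
     try have f3 := k10 r1 hr1 l4 hl4
     try have f4 := k01 r2 hr2 l3 hl3
     omega)

end Cell

/-! ### The extremal three orders -/

section SixCells

variable {m : ℕ}

/-- The level (low, middle or high third) of the cell `c` in the order `k`. The six cells realise
the six permutations of the levels, the even ones being those with `c.1 = true`. -/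
def cellLevel (c : Bool × Fin 3) (k : Fin 3) : Fin 3 := if c.1 then k + c.2 else c.2 - k

/-- The cell of the opposite parity that has the same level as `c` in the order `k`. -/
def partner (c : Bool × Fin 3) (k : Fin 3) : Bool × Fin 3 :=
  (!c.1, if c.1 then c.2 - k else c.2 + k)

theorem partner_partner : ∀ c k, partner (partner c k) k = c := by decide

theorem sum_partner (f : Bool × Fin 3 → ℕ) (c : Bool × Fin 3) :
    ∑ k, f (partner c k) = ∑ i, f (!c.1, i) := by
  obtain ⟨b, j⟩ := c
  cases b
  · exact Equiv.sum_comp (Equiv.addLeft j) fun i => f (true, i)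
  · exact Equiv.sum_comp (Equiv.subLeft j) fun i => f (false, i)

theorem sum_partner_snd (f : Fin 3 → ℤ) (b : Bool) (k : Fin 3) :
    ∑ i, f (partner (b, i) k).2 = ∑ j, f j := by
  cases b
  · exact Equiv.sum_comp (Equiv.addRight k) f
  · exact Equiv.sum_comp (Equiv.subRight k) f

/-- A shift, summing to zero over the three orders, that separates odd cells from even ones. -/
def cellShift (c : Bool × Fin 3) (k : Fin 3) : ℤ := if c.1 then 0 else ![1, 1, -2] k

/-- The position of a point of the cell `c` among the points of its level in the order `k`. -/
def levelPos (c : Bool × Fin 3) (k : Fin 3) (x : Bool × Fin m) : ℤ :=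
  4 * cellPos k x + cellShift c k

/-- The position in the order `k` of a point, given by its cell and its place in that cell. -/
def sixPos (k : Fin 3) (v : (Bool × Fin 3) × (Bool × Fin m)) : ℤ :=
  (16 * m + 16) * ((cellLevel v.1 k : ℕ) : ℤ) + levelPos v.1 k v.2

theorem cellShift_bounds : ∀ c k, -2 ≤ cellShift c k ∧ cellShift c k ≤ 1 := by decide

theorem cellLevel_cellShift_injective : ∀ k c d, cellLevel c k = cellLevel d k →
    cellShift c k % 4 = cellShift d k % 4 → c = d := by decide

theorem sum_levelPos (c : Bool × Fin 3) (x : Bool × Fin m) :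
    levelPos c 0 x + levelPos c 1 x + levelPos c 2 x = 4 * (6 * m - 2) := by
  have h1 : ∀ c, cellShift c 0 + cellShift c 1 + cellShift c 2 = 0 := by decide
  have h2 := h1 c
  have h3 := sum_cellPos x
  simp only [levelPos]
  linarith

theorem sixPos_lt_of_level_lt {k : Fin 3} {v w : (Bool × Fin 3) × (Bool × Fin m)}
    (h : cellLevel v.1 k < cellLevel w.1 k) : sixPos k v < sixPos k w := by
  have h1 := cellPos_nonneg k w.2
  have h2 := cellPos_lt k v.2
  have h3 := cellShift_bounds v.1 k
  have h4 := cellShift_bounds w.1 k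
  have h5 : (16 * (m : ℤ) + 16) * (((cellLevel v.1 k : ℕ) : ℤ) + 1) ≤
      (16 * m + 16) * ((cellLevel w.1 k : ℕ) : ℤ) := by
    have : (cellLevel v.1 k : ℕ) < cellLevel w.1 k := h
    gcongr
    omega
  rw [mul_add, mul_one] at h5
  simp only [sixPos, levelPos]
  linarith

theorem sixPos_injective (k : Fin 3) : Function.Injective (sixPos (m := m) k) := by
  intro v w h
  have hl : cellLevel v.1 k = cellLevel w.1 k := by
    by_contra hne
    rcases lt_or_gt_of_ne hne with hlt | hlt
    · exact (sixPos_lt_of_level_lt hlt).ne h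
    · exact (sixPos_lt_of_level_lt hlt).ne' h
  simp only [sixPos, hl, levelPos] at h
  have hc : v.1 = w.1 := cellLevel_cellShift_injective k _ _ hl (by omega)
  rw [hc] at h
  exact Prod.ext hc (cellPos_injective k (by omega))

/-- The three orders on `12 m` points. -/
abbrev sixOrders (m : ℕ) (k : Fin (2 * 2 - 1)) :
    LinearOrder ((Bool × Fin 3) × (Bool × Fin m)) :=
  LinearOrder.lift' (sixPos (k : Fin 3)) (sixPos_injective _)

theorem twoOfThree_of_adj {v w : (Bool × Fin 3) × (Bool × Fin m)}
    (h : (majorityTournament 2 (sixOrders m)).Adj v w) :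
    TwoOfThree fun k => sixPos k v < sixPos k w :=
  TwoOfThree.of_two_le_card h

/-- Between cells of equal parity the tournament is cyclic. -/
theorem not_adj_succ (b : Bool) (i : Fin 3) (x y : Bool × Fin m) :
    ¬ (majorityTournament 2 (sixOrders m)).Adj ((b, i + 1), x) ((b, i), y) := by
  intro h
  have hlev : ∀ b i, ∃ k l, k ≠ l ∧ cellLevel (b, i) k < cellLevel (b, i + 1) k ∧
      cellLevel (b, i) l < cellLevel (b, i + 1) l := by decide
  obtain ⟨k, l, hkl, hk, hl⟩ := hlev b i
  have hk' := sixPos_lt_of_level_lt (v := ((b, i), y)) (w := ((b, i + 1), x)) hk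
  have hl' := sixPos_lt_of_level_lt (v := ((b, i), y)) (w := ((b, i + 1), x)) hl
  rcases twoOfThree_of_adj h k l hkl with h1 | h1 <;> omega

/-- Between cells of opposite parity the order in which they share a level decides, as the other
two orders cancel. -/
theorem levelPos_lt_of_adj {c : Bool × Fin 3} {k : Fin 3} {x y : Bool × Fin m}
    (h : (majorityTournament 2 (sixOrders m)).Adj (c, x) (partner c k, y)) :
    levelPos c k x < levelPos (partner c k) k y := by
  have hlev : ∀ c k, cellLevel c k = cellLevel (partner c k) k ∧
      ∃ l, k ≠ l ∧ cellLevel (partner c k) l < cellLevel c l := by decide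
  obtain ⟨hk, l, hkl, hl⟩ := hlev c k
  have hl' := sixPos_lt_of_level_lt (v := (partner c k, y)) (w := (c, x)) hl
  rcases twoOfThree_of_adj h k l hkl with h1 | h1
  · simpa only [sixPos, hk, add_lt_add_iff_left] using h1
  · omega

theorem cellPos_le_of_adj {c : Bool × Fin 3} {k : Fin 3} {x y : Bool × Fin m}
    (h : (majorityTournament 2 (sixOrders m)).Adj (c, x) (partner c k, y)) :
    cellPos k x ≤ cellPos k y := by
  have h1 := levelPos_lt_of_adj h
  have h2 := cellShift_bounds c k
  have h3 := cellShift_bounds (partner c k) k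
  simp only [levelPos] at h1
  omega

theorem cellPos_of_adj {c : Bool × Fin 3} {x y : Bool × Fin m}
    (h : (majorityTournament 2 (sixOrders m)).Adj (c, x) (c, y)) :
    TwoOfThree fun k => cellPos k x < cellPos k y := by
  intro k l hkl
  have := twoOfThree_of_adj h k l hkl
  simpa [sixPos, levelPos] using this

/-- The part of `A` in the cell `c`. -/
def cellPart (A : Finset ((Bool × Fin 3) × (Bool × Fin m))) (c : Bool × Fin 3) :
    Finset (Bool × Fin m) :=
  Finset.univ.filter fun x => (c, x) ∈ A

theorem mem_cellPart {A : Finset ((Bool × Fin 3) × (Bool × Fin m))} {c : Bool × Fin 3}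
    {x : Bool × Fin m} : x ∈ cellPart A c ↔ (c, x) ∈ A := by
  simp [cellPart]

theorem card_eq_sum_cellPart (A : Finset ((Bool × Fin 3) × (Bool × Fin m))) :
    A.card = ∑ i, (cellPart A (true, i)).card + ∑ i, (cellPart A (false, i)).card := by
  have h1 : A = ((Finset.univ : Finset (Bool × Fin 3)).sigma (cellPart A)).map
      (Equiv.sigmaEquivProd _ _).toEmbedding := by
    ext ⟨c, x⟩
    simp [cellPart]
  conv_lhs => rw [h1]
  rw [Finset.card_map, Finset.card_sigma, Fintype.sum_prod_type, Fintype.sum_bool]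

/-- The cell sizes `α` of `A` and `β` of `B` cannot both add up to more than `2 m + 3`, given the
constraints imposed by all edges going from `A` to `B`. -/
theorem false_of_cell_sizes {α β : Bool × Fin 3 → ℕ}
    (hR : ∀ c, α c = 0 ∨ β c = 0 ∨ α c + β c ≤ m + 1)
    (hC : ∀ b i, α (b, i + 1) = 0 ∨ β (b, i) = 0)
    (hUβ : ∀ b j, m < β (b, j) → β (b, j) + ∑ i, α (!b, i) ≤ 2 * m + 3)
    (hUα : ∀ b i, m < α (b, i) → α (b, i) + ∑ j, β (!b, j) ≤ 2 * m + 3)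
    (hW : ∀ b, (∀ i, 0 < α (b, i)) → (∀ j, 0 < β (!b, j)) → False)
    (hα : 2 * m + 3 < ∑ i, α (true, i) + ∑ i, α (false, i))
    (hβ : 2 * m + 3 < ∑ i, β (true, i) + ∑ i, β (false, i)) : False := by
  have hsum : ∀ (f : Fin 3 → ℕ) (j : Fin 3), ∑ i, f i = f j + f (j + 1) + f (j + 2) := by
    intro f j
    fin_cases j <;> simp [Fin.sum_univ_three] <;> omega
  have hα' : ∀ b, 2 * m + 3 < ∑ i, α (b, i) + ∑ i, α (!b, i) := by
    intro b; cases b <;> simp <;> omega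
  have hβ' : ∀ b, 2 * m + 3 < ∑ i, β (b, i) + ∑ i, β (!b, i) := by
    intro b; cases b <;> simp <;> omega
  have hback : ∀ j : Fin 3, j + 2 + 1 = j := by decide
  -- A part of `B` filling more than half of its cell `c` leaves `A` only the cells of the
  -- opposite parity and the cell that precedes `c`, which is then more than half full.
  have hbig : ∀ b j, β (b, j) ≤ m := by
    intro b j
    by_contra! hlt
    have h1 := hUβ b j hlt
    have h2 := hR (b, j)
    have h3 := hC b j
    have h4 := hsum (fun i => α (b, i)) j
    have h5 := hα' b
    have h6 := hUα b (j + 2)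
    have h7 := hR (b, j + 2)
    have h8 := hC b (j + 1)
    rw [show j + 1 + 1 = j + 2 by rw [add_assoc]; rfl] at h8
    have h9 := hsum (fun i => β (b, i)) j
    have h10 := hβ' b
    omega
  have hbig' : ∀ b i, α (b, i) ≤ m := by
    intro b i
    by_contra! hlt
    have h1 := hUα b i hlt
    have h2 := hR (b, i)
    have h3 := hC b (i + 2)
    rw [hback] at h3
    have h4 := hsum (fun j => β (b, j)) i
    have h5 := hβ' b
    have h6 := hbig b (i + 1)
    omega
  have hpar : ∀ b, ∑ i, β (b, i) = 0 ∨ ∑ i, α (b, i) = 0 ∨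
      ∑ i, α (b, i) + ∑ i, β (b, i) ≤ 2 * m + 1 := by
    intro b
    simp only [Fin.sum_univ_three]
    have r0 := hR (b, 0)
    have r1 := hR (b, 1)
    have r2 := hR (b, 2)
    have c0 : α (b, 1) = 0 ∨ β (b, 0) = 0 := hC b 0
    have c1 : α (b, 2) = 0 ∨ β (b, 1) = 0 := hC b 1
    have c2 : α (b, 0) = 0 ∨ β (b, 2) = 0 := hC b 2
    have b0 := hbig b 0
    have b1 := hbig b 1
    have b2 := hbig b 2
    have a0 := hbig' b 0
    have a1 := hbig' b 1
    have a2 := hbig' b 2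
    omega
  -- If `A` lies in the cells of one parity and `B` in the others, each has to meet three cells.
  have hopp : ∀ b, ∑ i, α (!b, i) ≠ 0 ∨ ∑ i, β (b, i) ≠ 0 := by
    intro b
    by_contra! hcon
    obtain ⟨h1, h2⟩ := hcon
    have h3 := hα' b
    have h4 := hβ' b
    refine hW b (fun i => ?_) fun j => ?_
    · have h5 := hsum (fun i => α (b, i)) i
      have h6 := hbig' b (i + 1)
      have h7 := hbig' b (i + 2)
      omega
    · have h5 := hsum (fun i => β (!b, i)) j
      have h6 := hbig (!b) (j + 1)
      have h7 := hbig (!b) (j + 2)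
      omega
  have p1 := hpar true
  have p2 := hpar false
  have q1 := hopp true
  have q2 := hopp false
  simp only [Bool.not_true, Bool.not_false] at q1 q2
  omega

theorem card_above_le (x : Bool × Fin m) (k l : Fin 3) (hkl : k ≠ l) (S : Finset (Bool × Fin m))
    (h : ∀ b ∈ S, cellPos k x < cellPos k b ∧ cellPos l x < cellPos l b) : S.card ≤ m := by
  rcases S.eq_empty_or_nonempty with rfl | hS
  · simp
  have := card_add_card_le_of_cell (Finset.singleton_nonempty x) hS fun a ha b hb => by
    rw [Finset.mem_singleton.1 ha]
    exact TwoOfThree.of_two hkl (h b hb).1 (h b hb).2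
  rw [Finset.card_singleton] at this
  omega

theorem card_below_le (x : Bool × Fin m) (k l : Fin 3) (hkl : k ≠ l) (S : Finset (Bool × Fin m))
    (h : ∀ b ∈ S, cellPos k b < cellPos k x ∧ cellPos l b < cellPos l x) : S.card ≤ m := by
  rcases S.eq_empty_or_nonempty with rfl | hS
  · simp
  have := card_add_card_le_of_cell hS (Finset.singleton_nonempty x) fun a ha b hb => by
    rw [Finset.mem_singleton.1 hb]
    exact TwoOfThree.of_two hkl (h a ha).1 (h a ha).2
  rw [Finset.card_singleton] at this
  omega

theorem not_majorityPrecedes_sixOrders {A B : Finset ((Bool × Fin 3) × (Bool × Fin m))}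
    (hA : A.card = 2 * m + 4) (hB : B.card = 2 * m + 4) :
    ¬ MajorityPrecedes 2 (sixOrders m) A B := by
  intro h
  have hadj : ∀ c d x y, x ∈ cellPart A c → y ∈ cellPart B d →
      (majorityTournament 2 (sixOrders m)).Adj (c, x) (d, y) := fun c d x y hx hy =>
    h _ (mem_cellPart.1 hx) _ (mem_cellPart.1 hy)
  have hW : Fintype.card (Bool × Fin m) = 2 * m := by simp
  refine false_of_cell_sizes (m := m) (α := fun c => (cellPart A c).card)
    (β := fun c => (cellPart B c).card) ?_ ?_ ?_ ?_ ?_ ?_ ?_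
  · intro c
    rcases (cellPart A c).eq_empty_or_nonempty with h1 | h1
    · exact Or.inl (Finset.card_eq_zero.2 h1)
    rcases (cellPart B c).eq_empty_or_nonempty with h2 | h2
    · exact Or.inr (Or.inl (Finset.card_eq_zero.2 h2))
    exact Or.inr (Or.inr (card_add_card_le_of_cell h1 h2
      fun a ha b hb => cellPos_of_adj (hadj c c a b ha hb)))
  · intro b i
    by_contra! hcon
    obtain ⟨x, hx⟩ := Finset.card_ne_zero.1 hcon.1
    obtain ⟨y, hy⟩ := Finset.card_ne_zero.1 hcon.2
    exact not_adj_succ b i x y (hadj _ _ x y hx hy)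
  · intro b j hlt
    have := card_add_sum_card_le (p := cellPos) cellPos_injective card_above_le
      (A := fun k => cellPart A (partner (b, j) k)) (B := cellPart B (b, j))
      (fun k a ha y hy => cellPos_le_of_adj (c := partner (b, j) k) (by
        rw [partner_partner]
        exact hadj _ _ a y ha hy)) hlt
    rwa [hW, sum_partner (fun c => (cellPart A c).card)] at this
  · intro b i hlt
    -- Reversing all orders exchanges the roles of `A` and `B`.
    have := card_add_sum_card_le (p := fun k x => - cellPos k x)
      (fun k => neg_injective.comp (cellPos_injective k))
      (fun x k l hkl S hS => card_below_le x k l hkl S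
        fun y hy => ⟨neg_lt_neg_iff.1 (hS y hy).1, neg_lt_neg_iff.1 (hS y hy).2⟩)
      (A := fun k => cellPart B (partner (b, i) k)) (B := cellPart A (b, i))
      (fun k y hy a ha => neg_le_neg (cellPos_le_of_adj (hadj _ _ a y ha hy))) hlt
    rwa [hW, sum_partner (fun c => (cellPart B c).card)] at this
  · -- Add up the nine inequalities between one point from each of the six parts.
    intro b h1 h2
    choose x hx using fun i => Finset.card_pos.1 (h1 i)
    choose y hy using fun j => Finset.card_pos.1 (h2 j)
    have hlt : ∀ i k, levelPos (b, i) k (x i) <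
        levelPos (partner (b, i) k) k (y (partner (b, i) k).2) := fun i k =>
      levelPos_lt_of_adj (hadj _ _ _ _ (hx i) (hy _))
    have h3 : ∑ k, ∑ i, levelPos (b, i) k (x i) <
        ∑ k, ∑ i, levelPos (partner (b, i) k) k (y (partner (b, i) k).2) :=
      Finset.sum_lt_sum_of_nonempty Finset.univ_nonempty fun k _ =>
        Finset.sum_lt_sum_of_nonempty Finset.univ_nonempty fun i _ => hlt i k
    have h4 : ∀ k, ∑ i, levelPos (partner (b, i) k) k (y (partner (b, i) k).2) =
        ∑ j, levelPos (!b, j) k (y j) := fun k =>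
      sum_partner_snd (fun j => levelPos (!b, j) k (y j)) b k
    simp only [h4] at h3
    rw [Finset.sum_comm, Finset.sum_comm (s := Finset.univ) (t := Finset.univ)
      (f := fun k j => levelPos (!b, j) k (y j))] at h3
    simp only [Fin.sum_univ_three (fun k => levelPos _ k _), sum_levelPos] at h3
    exact lt_irrefl _ h3
  · rw [← card_eq_sum_cellPart]; omega
  · rw [← card_eq_sum_cellPart]; omega

end SixCells

theorem bNum_two_lt (m : ℕ) : bNum 2 (12 * m) < 2 * m + 4 := by
  rw [bNum_eq]
  refine (isPairRelation_majorityPrecedes (by norm_num)).maxPair_lt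
    (V := (Bool × Fin 3) × (Bool × Fin m)) ?_ (sixOrders m)
    fun A B _ hA hB => not_majorityPrecedes_sixOrders hA hB
  simp only [Fintype.card_prod, Fintype.card_bool, Fintype.card_fin]
  ring

theorem six_le_of_forall {β : ℝ} (h : ∀ m : ℕ, (m : ℝ) ≤ β * (bNum 2 m + 1)) (hβ : 1 ≤ β) :
    6 ≤ β := by
  by_contra! hlt
  obtain ⟨m, hm⟩ := exists_nat_gt (4 * β / (12 - 2 * β))
  rw [div_lt_iff₀ (by linarith)] at hm
  have h1 := h (12 * m)
  have h2 : (bNum 2 (12 * m) : ℝ) + 1 ≤ 2 * m + 4 := by exact_mod_cast bNum_two_lt m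
  have h3 : β * ((bNum 2 (12 * m) : ℝ) + 1) ≤ β * (2 * m + 4) := by gcongr
  push_cast at h1
  linarith

/-! ### The limits -/

theorem tendsto_atTop_of_div_le {f : ℕ → ℕ} {C : ℕ} (hC : 1 ≤ C) (h : ∀ n, n / C ≤ f n) :
    Tendsto f atTop atTop :=
  tendsto_atTop_mono h (Nat.tendsto_div_const_atTop (by omega))

theorem exists_limit_bNum {k : ℕ} (hk : 1 ≤ k) : ∃ β : ℝ,
    Tendsto (fun n : ℕ => (n : ℝ) / (bNum k n : ℝ)) atTop (𝓝 β) ∧ 1 ≤ β ∧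
      β ≤ ((2 * k).choose k : ℝ) ∧ ∀ m : ℕ, (m : ℝ) ≤ β * (bNum k m + 1) :=
  (isPairRelation_majorityPrecedes hk).exists_limit (Nat.choose_pos (by omega))
    fun n => (div_choose_le_dNum hk n).trans (dNum_le_bNum hk n)

theorem exists_limit_dNum {k : ℕ} (hk : 1 ≤ k) : ∃ β : ℝ,
    Tendsto (fun n : ℕ => (n : ℝ) / (dNum k n : ℝ)) atTop (𝓝 β) ∧
      (2 : ℝ) ^ k / Real.exp 1 ≤ β ∧ β ≤ ((2 * k).choose k : ℝ) ∧ 1 ≤ β ∧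
      ∀ m : ℕ, (m : ℝ) ≤ β * (dNum k m + 1) := by
  obtain ⟨β, h1, h2, h3, h4⟩ := (isPairRelation_majorityDominates hk).exists_limit
    (Nat.choose_pos (by omega)) (div_choose_le_dNum hk)
  refine ⟨β, h1, ?_, h3, h2, h4⟩
  obtain ⟨j, rfl⟩ : ∃ j, k = j + 1 := ⟨k - 1, by omega⟩
  exact two_pow_div_exp_le h1
    (tendsto_atTop_of_div_le (Nat.choose_pos (by omega)) (div_choose_le_dNum hk))
    (centralBinom_pow_le_of_dNum j)

theorem exists_limit_dStarNum {k : ℕ} (hk : 1 ≤ k) : ∃ β : ℝ,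
    Tendsto (fun n : ℕ => (n : ℝ) / (dStarNum k n : ℝ)) atTop (𝓝 β) ∧
      (2 : ℝ) ^ (2 * k - 1) / Real.exp 1 ≤ β ∧ β ≤ (2 : ℝ) ^ (2 * k - 1) := by
  obtain ⟨β, h1, -, h3, -⟩ := (isPairRelation_consistent hk).exists_limit
    Nat.one_le_two_pow (div_two_pow_le_dStarNum hk)
  refine ⟨β, h1, ?_, by exact_mod_cast h3⟩
  obtain ⟨j, rfl⟩ : ∃ j, k = j + 1 := ⟨k - 1, by omega⟩
  exact two_pow_div_exp_le (j := 2 * j) h1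
    (tendsto_atTop_of_div_le Nat.one_le_two_pow (div_two_pow_le_dStarNum hk))
    (centralBinom_pow_le_of_dStarNum j)

end KMajority

theorem theorem2 :
    ∃ b d dStar : ℕ → ℝ,
      (∀ k : ℕ, 1 ≤ k →
        Tendsto (fun n : ℕ => (n : ℝ) / (KMajority.bNum k n : ℝ)) atTop (𝓝 (b k)) ∧
        Tendsto (fun n : ℕ => (n : ℝ) / (KMajority.dNum k n : ℝ)) atTop (𝓝 (d k)) ∧
        Tendsto (fun n : ℕ => (n : ℝ) / (KMajority.dStarNum k n : ℝ)) atTop (𝓝 (dStar k))) ∧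
      (∃ c : ℝ, 0 < c ∧ ∀ k : ℕ, 1 ≤ k → c * (k : ℝ) ≤ b k) ∧
      (∀ k : ℕ, 1 ≤ k →
        b k ≤ ((2 * k).choose k : ℝ) ∧
        (2 : ℝ) ^ k / Real.exp 1 ≤ d k ∧ d k ≤ ((2 * k).choose k : ℝ) ∧
        (2 : ℝ) ^ (2 * k - 1) / Real.exp 1 ≤ dStar k ∧ dStar k ≤ (2 : ℝ) ^ (2 * k - 1)) ∧
      b 2 = 6 ∧ d 2 = 6 := by
  choose! b hb hb1 hbC hbm using fun (k : ℕ) (hk : 1 ≤ k) => KMajority.exists_limit_bNum hk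
  choose! d hd hde hdC hd1 hdm using fun (k : ℕ) (hk : 1 ≤ k) => KMajority.exists_limit_dNum hk
  choose! s hs hse hsC using fun (k : ℕ) (hk : 1 ≤ k) => KMajority.exists_limit_dStarNum hk
  obtain ⟨c, hc, hck⟩ := KMajority.exists_linear_lower_bound
  have hchoose : ((2 * 2).choose 2 : ℝ) = 6 := by norm_num [Nat.choose]
  refine ⟨b, d, s, fun k hk => ⟨hb k hk, hd k hk, hs k hk⟩,
    ⟨c, hc, fun k hk => hck k (b k) hk (hb1 k hk) (hbm k hk)⟩,
    fun k hk => ⟨hbC k hk, hde k hk, hdC k hk, hse k hk, hsC k hk⟩, ?_, ?_⟩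
  · refine le_antisymm ((hbC 2 one_le_two).trans hchoose.le) ?_
    exact KMajority.six_le_of_forall (hbm 2 one_le_two) (hb1 2 one_le_two)
  · refine le_antisymm ((hdC 2 one_le_two).trans hchoose.le) ?_
    refine KMajority.six_le_of_forall (fun m => (hdm 2 one_le_two m).trans ?_) (hd1 2 one_le_two)
    have h1 := hd1 2 one_le_two
    have h2 : (KMajority.dNum 2 m : ℝ) ≤ KMajority.bNum 2 m := by
      exact_mod_cast KMajority.dNum_le_bNum one_le_two m
    gcongr
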